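/- Let $T$ be a first-order theory, in a language of any size, all of whose models are infinite (e.g. a complete theory with infinite models). For a model $O \models T$ let $\mathbb{O} \succeq O$ denote an ambient $|O|^+$-saturated ("monster") model. Tuples $d$ and tuples of variables $x,y$ are finite, and a global type is a complete type over $\mathbb{O}$. **Definitions.** (a) $T$ has ATP if there are a formula $\varphi(x,y)$ and a tree $(b_\sigma)_{\sigma\in 2^{<\omega}}$ in a model of $T$ such that $\{\varphi(x,b_\sigma):\sigma\in X\}$ is consistent for every antichain $X\subseteq 2^{<\omega}$, and $\{\varphi(x,b_\sigma),\varphi(x,b_\tau)\}$ is inconsistent whenever $\sigma$ is a proper initial segment of $\tau$. $T$ is NATP if it does not have ATP. (b) A global type $q(y)$ is $A$-invariant if, for every $A$-formula $\varphi(y,z)$, whether $\varphi(y,b)\in q$ depends only on $\mathrm{tp}(b/A)$. For $A\subseteq C$, write $d \perp^{i}_A C$ if $\mathrm{tp}(d/C)$ extends to a global $A$-invariant type. A Morley sequence over $A$ generated by $q$ is a sequence $(e_i)_{i<\omega}$ with $e_i\models q\restriction A e_{<i}$ for all $i$; similarly $(e_0,\dots,e_{r-1})\models q^{\otimes r}\restriction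 C$ means that $e_i\models q\restriction C e_{<i}$ for all $i<r$. The formula $\varphi(x,y)$ $q$-Kim-divides (over $A$) if $\{\varphi(x,e_i):i<\omega\}$ is inconsistent for a Morley sequence $(e_i)_{i<\omega}$ over $A$ generated by $q$, and $\varphi(x,d)$ Kim-divides over $A$ if $\varphi(x,y)$ $q$-Kim-divides for some global $A$-invariant $q\supseteq\mathrm{tp}(d/A)$. (c) A global type $p(y)$ is strongly $A$-bi-invariant if it is $A$-invariant and, for every $r<\omega$, whenever $a\models p^{\otimes r}\restriction Ab$, the type $\mathrm{tp}(b/Aa)$ extends to a global $A$-invariant type. (d) For models $M\preceq N \preceq O$ and $p\in S(O)$, $\Xi(p,M,N)$ is the condition: for every $M$-formula $\varphi(x,y)$ and every tuple $d$ of $O$ with $\varphi(x,d)\in p$ and $d\perp^{i}_M N$, the formula $\varphi(x,d)$ does not Kim-divide over $N$. (e) For a set $O$ and a cardinal $\kappa$ let $[O]^\kappa=\{X\subseteq O:|X|=\kappa\}$. A club in $[O]^\kappa$ is a subset that is cofinal under $\subseteq$ and closed under unions of nonempty chains of at most $\kappa$ members. A set is stationary in $[O]^\kappa$ if it meets every club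 in $[O]^\kappa$. (f) $T$ satisfies generic stationary local character if for every cardinal $\lambda$ there is a cardinal $\kappa$ such that for every $\kappa^+$-saturated model $O\models T$, every type $p(x)\in S(O)$ in finitely many variables, and every $M\preceq O$ with $|M|\le\lambda$, the set $$\{N\preceq O : M\preceq N,\ |N|\le\kappa,\ \Xi(p,M,N)\}$$ is stationary in $[O]^\kappa$. **Theorem.** (1) If $T$ is NATP, then $T$ satisfies generic stationary local character. (2) If $T$ does not satisfy generic stationary local character, then there are a model $N\models T$, elementary in an $|N|^+$-saturated ambient model, a formula $\varphi(x,y)$, a tuple $d$ of the ambient model, a strongly $N$-bi-invariant global type $p(y)\supseteq\mathrm{tp}(d/N)$ and an $N$-invariant global type $q(y)\supseteq\mathrm{tp}(d/N)$ such that $\varphi(x,y)$ $q$-Kim-divides but does not $p$-Kim-divide (both over $N$). -/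

import Mathlib

universe u v w

open FirstOrder

namespace LocalCharacter

section Types

variable {L : FirstOrder.Language.{u, v}} {𝕆 : Type w} [L.Structure 𝕆]

/-- `S_n(A)`: complete `n`-types over the parameter set `A ⊆ 𝕆`, for the theory of `𝕆` with constants
for the elements of `A`. -/
abbrev TypeOver (L : FirstOrder.Language.{u, v}) {𝕆 : Type w} [L.Structure 𝕆] (A : Set 𝕆) (n : ℕ) :=
  (L[[A]].completeTheory 𝕆).CompleteType (Fin n)

/-- Global types: complete types over the whole ambient model. -/
abbrev GlobalType (L : FirstOrder.Language.{u, v}) (𝕆 : Type w) [L.Structure 𝕆] (n : ℕ) :=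
  TypeOver L (Set.univ : Set 𝕆) n

/-- `tp(a/A)`. -/
def tp [Nonempty 𝕆] (A : Set 𝕆) {n : ℕ} (a : Fin n → 𝕆) : TypeOver L A n :=
  (L[[A]].completeTheory 𝕆).typeOf a

/-- The `A`-formula `φ(x)` belongs to the type `p` over `A`. -/
def TypeOver.Has {A : Set 𝕆} {n : ℕ} (p : TypeOver L A n) (φ : L[[A]].Formula (Fin n)) : Prop :=
  FirstOrder.Language.Formula.equivSentence φ ∈ p

/-- An `A`-formula seen as a `B`-formula, where `A ⊆ B`. -/
def lift {A B : Set 𝕆} (h : A ⊆ B) {α : Type*} (φ : L[[A]].Formula α) : L[[B]].Formula α :=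
  (L.lhomWithConstantsMap (Set.inclusion h)).onFormula φ

/-- The `A`-formula `φ(x, b)` obtained from an `A`-formula `φ(x, y)` and a tuple `b` from `A`. -/
def plug {A : Set 𝕆} {α β : Type*} (φ : L[[A]].Formula (α ⊕ β)) (b : β → A) : L[[A]].Formula α :=
  FirstOrder.Language.BoundedFormula.subst φ
    (Sum.elim FirstOrder.Language.Term.var fun j => (L.con (b j)).term)

theorem realize_lift {A B : Set 𝕆} (h : A ⊆ B) {α : Type*} (φ : L[[A]].Formula α) (a : α → 𝕆) :
    (lift h φ).Realize a ↔ φ.Realize a :=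
  FirstOrder.Language.LHom.realize_onFormula _ φ

theorem realize_plug {A : Set 𝕆} {α β : Type*} (φ : L[[A]].Formula (α ⊕ β)) (b : β → A)
    (a : α → 𝕆) : (plug φ b).Realize a ↔ φ.Realize (Sum.elim a fun j => (b j : 𝕆)) := by
  unfold plug FirstOrder.Language.Formula.Realize
  rw [FirstOrder.Language.BoundedFormula.realize_subst]
  have : (fun i => FirstOrder.Language.Term.realize a ((Sum.elim FirstOrder.Language.Term.var fun j => (L.con (b j)).term :
      α ⊕ β → L[[A]].Term α) i)) = Sum.elim a fun j => (b j : 𝕆) := by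
    funext i
    cases i <;> simp
  rw [this]

/-- `κ`-saturation: every complete type in finitely many variables over fewer than `κ` parameters
is realized. -/
def IsSaturated (L : FirstOrder.Language.{u, v}) (κ : Cardinal.{w}) (K : Type w) [L.Structure K]
    [Nonempty K] : Prop :=
  ∀ A : Set K, Cardinal.mk A < κ → ∀ (n : ℕ) (p : TypeOver L A n), ∃ a : Fin n → K, tp A a = p

/-- `a ⊨ q ↾ C` for a global type `q`, i.e. `q` extends `tp(a/C)`. -/
def RealizesRestriction {m : ℕ} (q : GlobalType L 𝕆 m) (C : Set 𝕆) (a : Fin m → 𝕆) : Prop :=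
  ∀ ψ : L[[C]].Formula (Fin m), q.Has (lift (Set.subset_univ C) ψ) ↔ ψ.Realize a

/-- The global type `q` is `A`-invariant: whether `φ(x, b) ∈ q`, for an `A`-formula `φ(x, y)`,
depends only on `tp(b/A)`. -/
def IsInvariant [Nonempty 𝕆] {m : ℕ} (q : GlobalType L 𝕆 m) (A : Set 𝕆) : Prop :=
  ∀ (k : ℕ) (φ : L[[A]].Formula (Fin m ⊕ Fin k)) (b b' : Fin k → 𝕆),
    (tp A b : TypeOver L A k) = tp A b' →
      (q.Has (plug (lift (Set.subset_univ A) φ) fun j => ⟨b j, trivial⟩) ↔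
        q.Has (plug (lift (Set.subset_univ A) φ) fun j => ⟨b' j, trivial⟩))

/-- `tp(d/C)` extends to a global `A`-invariant type. For `A ⊆ C` this is the relation
`d ⫝ⁱ_A C` of invariant independence. -/
def InvariantlyIndep (L : FirstOrder.Language.{u, v}) {𝕆 : Type w} [L.Structure 𝕆] [Nonempty 𝕆]
    (A C : Set 𝕆) {m : ℕ} (d : Fin m → 𝕆) : Prop :=
  ∃ q : GlobalType L 𝕆 m, IsInvariant q A ∧ RealizesRestriction q C d

/-- The set of formulas `{φ(x, b i) : i ∈ X}` is (finitely) consistent. -/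
def ConsistentOn {L' : FirstOrder.Language} [L'.Structure 𝕆] {n m : ℕ} (φ : L'.Formula (Fin n ⊕ Fin m))
    {ι : Type*} (b : ι → Fin m → 𝕆) (X : Set ι) : Prop :=
  ∀ s : Finset ι, (s : Set ι) ⊆ X → ∃ x : Fin n → 𝕆, ∀ i ∈ s, φ.Realize (Sum.elim x (b i))

/-- `(e i)_{i < ω}` is a Morley sequence over `A` generated by `q`: `e i ⊨ q ↾ A e_{<i}`. -/
def IsMorleySequence {m : ℕ} (q : GlobalType L 𝕆 m) (A : Set 𝕆) (e : ℕ → Fin m → 𝕆) : Prop :=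
  ∀ i, RealizesRestriction q (A ∪ ⋃ j, ⋃ (_ : j < i), Set.range (e j)) (e i)

/-- `φ(x, y)` `q`-Kim-divides (over `A`): it divides along a Morley sequence over `A` generated by
`q`. -/
def KimDividesAlong {n m : ℕ} (A : Set 𝕆) (φ : L[[A]].Formula (Fin n ⊕ Fin m))
    (q : GlobalType L 𝕆 m) : Prop :=
  ∃ e : ℕ → Fin m → 𝕆, IsMorleySequence q A e ∧ ¬ ConsistentOn φ e Set.univ

/-- `φ(x, d)` Kim-divides over `A`: `φ(x, y)` `q`-Kim-divides for some global `A`-invariant type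
`q ⊇ tp(d/A)`. -/
def KimDivides [Nonempty 𝕆] {n m : ℕ} (A : Set 𝕆) (φ : L[[A]].Formula (Fin n ⊕ Fin m))
    (d : Fin m → 𝕆) : Prop :=
  ∃ q : GlobalType L 𝕆 m, IsInvariant q A ∧ RealizesRestriction q A d ∧ KimDividesAlong A φ q

/-- `a = (a 0, …, a (r - 1))` realizes `p^{⊗ r} ↾ C`: `a i ⊨ p ↾ C a_{<i}` for every `i < r`. -/
def RealizesPower {m : ℕ} (p : GlobalType L 𝕆 m) (C : Set 𝕆) {r : ℕ} (a : Fin r → Fin m → 𝕆) :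
    Prop :=
  ∀ i, RealizesRestriction p (C ∪ ⋃ j, ⋃ (_ : j < i), Set.range (a j)) (a i)

/-- `p` is strongly `A`-bi-invariant: `p` is `A`-invariant and for every `r`, whenever
`a ⊨ p^{⊗ r} ↾ A b`, the type `tp(b/Aa)` extends to a global `A`-invariant type. -/
def IsStronglyBiInvariant [Nonempty 𝕆] {m : ℕ} (p : GlobalType L 𝕆 m) (A : Set 𝕆) : Prop :=
  IsInvariant p A ∧
    ∀ (r k : ℕ) (a : Fin r → Fin m → 𝕆) (b : Fin k → 𝕆),
      RealizesPower p (A ∪ Set.range b) a →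
        InvariantlyIndep L A (A ∪ ⋃ i, Set.range (a i)) b

/-- The condition `Ξ(p, M, N)`, for `p` a type over `O` and `M ⊆ N`, `M ⊆ O`: for every `M`-formula
`φ(x, y)` and every `d` with `φ(x, d) ∈ p` and `d ⫝ⁱ_M N`, `φ(x, d)` does not Kim-divide
over `N`. -/
def Xi [Nonempty 𝕆] {O M N : Set 𝕆} (hMO : M ⊆ O) (hMN : M ⊆ N) {n : ℕ} (p : TypeOver L O n) :
    Prop :=
  ∀ (m : ℕ) (φ : L[[M]].Formula (Fin n ⊕ Fin m)) (d : Fin m → O),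
    p.Has (plug (lift hMO φ) d) →
      InvariantlyIndep L M N (fun j => (d j : 𝕆)) →
        ¬ KimDivides N (lift hMN φ) (fun j => (d j : 𝕆))

end Types

section Clubs

variable {S : Type w}

/-- `[O]^κ`, the set of subsets of `O` of cardinality `κ`. -/
def subsetsOfCard (O : Set S) (κ : Cardinal.{w}) : Set (Set S) :=
  {X | X ⊆ O ∧ Cardinal.mk X = κ}

/-- `C` is a club in `[O]^κ`: it is unbounded, and closed under unions of nonempty chains of at most
`κ` members. -/
def IsClubIn (O : Set S) (κ : Cardinal.{w}) (C : Set (Set S)) : Prop :=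
  C ⊆ subsetsOfCard O κ ∧
  (∀ Y ∈ subsetsOfCard O κ, ∃ X ∈ C, Y ⊆ X) ∧
  ∀ D : Set (Set S), D ⊆ C → D.Nonempty → IsChain (· ⊆ ·) D → Cardinal.mk D ≤ κ → ⋃₀ D ∈ C

/-- `E` is stationary in `[O]^κ`: it meets every club. -/
def IsStationaryIn (O : Set S) (κ : Cardinal.{w}) (E : Set (Set S)) : Prop :=
  ∀ C, IsClubIn O κ C → (E ∩ C).Nonempty

end Clubs

section Theories

variable {L : FirstOrder.Language.{u, v}}

/-- `T` has the antichain tree property: some formula `φ(x, y)` and some tree `(b_σ)_{σ ∈ 2^{<ω}}`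
in a model of `T` are such that `{φ(x, b_σ) : σ ∈ X}` is consistent for each antichain `X`, while
`φ(x, b_σ)` and `φ(x, b_τ)` are inconsistent whenever `σ` is a proper initial segment of `τ`. -/
def HasATP (T : L.Theory) : Prop :=
  ∃ (K : FirstOrder.Language.Theory.ModelType.{u, v, w} T) (n m : ℕ) (φ : L.Formula (Fin n ⊕ Fin m))
    (b : List Bool → Fin m → K),
    (∀ X : Set (List Bool), IsAntichain (fun σ τ => σ <+: τ) X → ConsistentOn φ b X) ∧
    ∀ σ τ : List Bool, σ <+: τ → σ ≠ τ →
      ¬ ∃ x : Fin n → K, φ.Realize (Sum.elim x (b σ)) ∧ φ.Realize (Sum.elim x (b τ))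

/-- `T` is NATP. -/
def IsNATP (T : L.Theory) : Prop := ¬ HasATP.{u, v, w} T

/-- Generic stationary local character. The ambient model `𝕆` plays the role of the monster model:
`O` is small in it, in the sense that `𝕆` is `|O|⁺`-saturated. -/
def GenericStationaryLocalCharacter (T : L.Theory) : Prop :=
  ∀ lam : Cardinal.{w}, ∃ κ : Cardinal.{w},
    ∀ (𝕆 : FirstOrder.Language.Theory.ModelType.{u, v, w} T) (O : L.ElementarySubstructure 𝕆),
      IsSaturated L (Order.succ (Cardinal.mk O)) 𝕆 →
      IsSaturated L (Order.succ κ) O →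
      ∀ (n : ℕ) (p : TypeOver L (O : Set 𝕆) n) (M : L.ElementarySubstructure 𝕆)
        (hMO : (M : Set 𝕆) ⊆ O), Cardinal.mk M ≤ lam →
        IsStationaryIn (O : Set 𝕆) κ
          {X | ∃ (N : L.ElementarySubstructure 𝕆) (hMN : (M : Set 𝕆) ⊆ N),
            (N : Set 𝕆) = X ∧ (N : Set 𝕆) ⊆ O ∧ Cardinal.mk N ≤ κ ∧ Xi hMO hMN p}

/-- `T` fails Kim's lemma for strongly bi-invariant types: there are a small model `N`, a formula
`φ(x, d)`, a strongly `N`-bi-invariant type `p ⊇ tp(d/N)` and an `N`-invariant type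
`q ⊇ tp(d/N)` such that `φ(x, y)` `q`-Kim-divides but does not `p`-Kim-divide. -/
def StrongBiInvariantKimFailure (T : L.Theory) : Prop :=
  ∃ (𝕆 : FirstOrder.Language.Theory.ModelType.{u, v, w} T) (N : L.ElementarySubstructure 𝕆),
    IsSaturated L (Order.succ (Cardinal.mk N)) 𝕆 ∧
    ∃ (n m : ℕ) (φ : L.Formula (Fin n ⊕ Fin m)) (d : Fin m → 𝕆) (p q : GlobalType L 𝕆 m),
      IsStronglyBiInvariant p (N : Set 𝕆) ∧ RealizesRestriction p (N : Set 𝕆) d ∧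
      IsInvariant q (N : Set 𝕆) ∧ RealizesRestriction q (N : Set 𝕆) d ∧
      KimDividesAlong (N : Set 𝕆) ((L.lhomWithConstants (N : Set 𝕆)).onFormula φ) q ∧
      ¬ KimDividesAlong (N : Set 𝕆) ((L.lhomWithConstants (N : Set 𝕆)).onFormula φ) p

end Theories

end LocalCharacter

/-! Part (1) follows from part (2) and one more implication: a failure of Kim's lemma for strongly
bi-invariant types produces ATP. Types are handled as ultrafilters on tuples of the ambient model,
so that invariance and realization become statements about definable sets.

For (2), let `μ` bound `lam`, `ℵ₀` and the size of the language, and test the failure with `κ =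
2^(2^μ)`. This yields `p` over `O`, `M` and a club that contains no good `N`. An `M`-invariant type
`U` is determined by its traces over `M`, so there are at most `κ` pairs of a formula `φ` and such a
type. For each pair, the Morley sequences in `U` over `M` that lie in `O` and whose instances of `φ`
belong to `p` either have all lengths or have a maximal one. Let `A` collect the entries of one
maximal sequence for each pair of the second kind (`exists_bounding`). The club has a member `N`
that contains `A` and is full over `M`: types over `M` and finitely many elements of `N` are
realized in `N`. As `N` is not good, some `φ(x, d)` in `p` Kim-divides over `N` although `d`
realizes over `N` an `M`-invariant `U`. Since `d` would prolong a maximal sequence, there are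
sequences of all lengths; their instances of `φ` lie in `p`, so `φ` does not Kim-divide along `U`.
Fullness makes `U` strongly `N`-bi-invariant (`isStronglyBiInvariant_of_isFullOver`): `tp(b/Na)` is
finitely satisfiable in `N`.

For the other implication, strong bi-invariance of `p` allows building finite binary trees whose
antichains are Morley sequences in `p` and whose paths, from the top down, are Morley sequences in
`q` (`exists_isMorleyTree`). Hence antichains are consistent, and chains of some fixed size `k` are
not. To pass from `k` to pairs, suppose that ATP fails. Then each node can be replaced by two
comparable ones without losing consistency of antichains, because the obstruction, made uniform by a
Ramsey theorem for trees, would itself be ATP (`FatPattern.insert`). Doubling all nodes halves the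
size of inconsistent chains (`TreePattern.double`), and size one is absurd. -/

namespace LocalCharacter

/-! ### Types of tuples and invariance in terms of definable sets and ultrafilters -/

section Definability

variable {L : FirstOrder.Language.{u, v}} {𝕆 : Type w} [L.Structure 𝕆]

/-- Two tuples have the same type over `A`: they lie in the same `A`-definable sets. -/
def SameType (L : FirstOrder.Language.{u, v}) {𝕆 : Type w} [L.Structure 𝕆] (A : Set 𝕆) {ι : Type*}
    (a b : ι → 𝕆) : Prop :=
  ∀ S : Set (ι → 𝕆), A.Definable L S → (a ∈ S ↔ b ∈ S)

/-- An ultrafilter on tuples is `A`-invariant if the type it defines is. -/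
def InvariantUF (L : FirstOrder.Language.{u, v}) {𝕆 : Type w} [L.Structure 𝕆] {ι : Type*}
    (U : Ultrafilter (ι → 𝕆)) (A : Set 𝕆) : Prop :=
  ∀ (k : ℕ) (S : Set (ι ⊕ Fin k → 𝕆)), A.Definable L S → ∀ b b' : Fin k → 𝕆, SameType L A b b' →
    ({x | Sum.elim x b ∈ S} ∈ U ↔ {x | Sum.elim x b' ∈ S} ∈ U)

/-- `a` realizes the restriction to `C` of the type defined by an ultrafilter on tuples. -/
def RealizesUF (L : FirstOrder.Language.{u, v}) {𝕆 : Type w} [L.Structure 𝕆] {ι : Type*}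
    (U : Ultrafilter (ι → 𝕆)) (C : Set 𝕆) (a : ι → 𝕆) : Prop :=
  ∀ S : Set (ι → 𝕆), C.Definable L S → (S ∈ U ↔ a ∈ S)

variable {A B C : Set 𝕆} {ι ι' γ γ' : Type*}

theorem definable_fiber {S : Set (ι ⊕ γ → 𝕆)} (hS : A.Definable L S) (hA : A ⊆ C) {b : γ → 𝕆}
    (hb : Set.range b ⊆ C) : C.Definable L {x | Sum.elim x b ∈ S} := by
  obtain ⟨φ, rfl⟩ := hS
  refine ⟨plug (lift hA φ) fun j => ⟨b j, hb ⟨j, rfl⟩⟩, ?_⟩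
  ext x
  change φ.Realize (Sum.elim x b) ↔ (plug (lift hA φ) fun j => ⟨b j, hb ⟨j, rfl⟩⟩).Realize x
  rw [realize_plug, realize_lift]

theorem exists_definable_fiber_eq {b : γ → 𝕆} {S : Set (ι → 𝕆)}
    (hS : (A ∪ Set.range b).Definable L S) :
    ∃ S' : Set (ι ⊕ γ → 𝕆), A.Definable L S' ∧ ∀ x, x ∈ S ↔ Sum.elim x b ∈ S' := by
  classical
  obtain ⟨φ, rfl⟩ := Set.definable_iff_exists_formula_sum.1 hS
  have key : ∀ c : (A ∪ Set.range b : Set 𝕆), ∃ t : A ⊕ γ, Sum.elim (↑) b t = (c : 𝕆) := by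
    rintro ⟨c, hc | ⟨j, rfl⟩⟩
    · exact ⟨Sum.inl ⟨c, hc⟩, rfl⟩
    · exact ⟨Sum.inr j, rfl⟩
  choose t ht using key
  let f : (A ∪ Set.range b : Set 𝕆) ⊕ ι → A ⊕ (ι ⊕ γ) :=
    Sum.elim (fun c => Sum.elim Sum.inl (fun j => Sum.inr (Sum.inr j)) (t c))
      (fun i => Sum.inr (Sum.inl i))
  refine ⟨_, Set.definable_iff_exists_formula_sum.2 ⟨φ.relabel f, rfl⟩, fun x => ?_⟩
  change φ.Realize _ ↔ (φ.relabel f).Realize _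
  rw [FirstOrder.Language.Formula.realize_relabel]
  have : (Sum.elim (↑) (Sum.elim x b) : A ⊕ (ι ⊕ γ) → 𝕆) ∘ f = Sum.elim (↑) x := by
    funext c
    rcases c with c | i
    · have := ht c
      simp only [f, Function.comp, Sum.elim_inl]
      rcases h : t c with a | j <;> rw [h] at this <;> simpa using this
    · rfl
  rw [this]

namespace SameType

theorem refl (a : ι → 𝕆) : SameType L A a a := fun _ _ => Iff.rfl

theorem symm {a b : ι → 𝕆} (h : SameType L A a b) : SameType L A b a := fun S hS => (h S hS).symm

theorem trans {a b c : ι → 𝕆} (h : SameType L A a b) (h' : SameType L A b c) : SameType L A a c :=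
  fun S hS => (h S hS).trans (h' S hS)

theorem mono {a b : ι → 𝕆} (h : SameType L B a b) (hAB : A ⊆ B) : SameType L A a b :=
  fun S hS => h S (hS.mono hAB)

theorem comp {a b : ι → 𝕆} (h : SameType L A a b) (f : ι' → ι) : SameType L A (a ∘ f) (b ∘ f) :=
  fun _ hS => h _ (hS.preimage_comp f)

theorem adjoin {b : γ → 𝕆} {a a' : ι → 𝕆} (h : SameType L (A ∪ Set.range b) a a') :
    SameType L A (Sum.elim a b) (Sum.elim a' b) :=
  fun _ hS => h _ (definable_fiber hS Set.subset_union_left Set.subset_union_right)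

end SameType

theorem RealizesUF.mono {U : Ultrafilter (ι → 𝕆)} {a : ι → 𝕆} (h : RealizesUF L U C a)
    (hBC : B ⊆ C) : RealizesUF L U B a := fun S hS => h S (hS.mono hBC)

theorem RealizesUF.sameType {U : Ultrafilter (ι → 𝕆)} {a b : ι → 𝕆} (h : RealizesUF L U C a)
    (h' : RealizesUF L U C b) : SameType L C a b := fun S hS => (h S hS).symm.trans (h' S hS)

theorem RealizesUF.of_sameType {U : Ultrafilter (ι → 𝕆)} {a b : ι → 𝕆} (h : RealizesUF L U C a)
    (h' : SameType L C a b) : RealizesUF L U C b := fun S hS => (h S hS).trans (h' S hS)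

theorem InvariantUF.mem_iff [Finite γ] {U : Ultrafilter (ι → 𝕆)} (h : InvariantUF L U A)
    {S : Set (ι ⊕ γ → 𝕆)} (hS : A.Definable L S) {b b' : γ → 𝕆} (hb : SameType L A b b') :
    {x | Sum.elim x b ∈ S} ∈ U ↔ {x | Sum.elim x b' ∈ S} ∈ U := by
  obtain ⟨k, ⟨e⟩⟩ := Finite.exists_equiv_fin γ
  have := h k _ (hS.preimage_comp (Sum.map id e)) (b ∘ e.symm) (b' ∘ e.symm) (hb.comp _)
  have aux : ∀ c : γ → 𝕆, ∀ x : ι → 𝕆,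
      (Sum.elim x (c ∘ e.symm) ∘ (Sum.map id e : ι ⊕ γ → ι ⊕ Fin k)) = Sum.elim x c := by
    intro c x
    funext i
    rcases i with i | i <;> simp
  simpa only [Set.mem_preimage, aux, Set.mem_ofPred_eq] using this

/-- A `B`-definable set uses finitely many parameters. Appended to `b` and `b'`, they leave a set
definable without parameters, and the extended tuples still have the same type over `A`, so
invariance over `A` applies. -/
theorem InvariantUF.mono {U : Ultrafilter (ι → 𝕆)} (h : InvariantUF L U A) (hAB : A ⊆ B) :
    InvariantUF L U B := by
  intro k S hS b b' hb
  obtain ⟨B₀, hB₀, hS⟩ := Set.definable_iff_finitely_definable.1 hS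
  have hr : (∅ : Set 𝕆) ∪ Set.range (Subtype.val : B₀ → 𝕆) = B₀ := by simp
  obtain ⟨S', hS', hx⟩ := exists_definable_fiber_eq (A := (∅ : Set 𝕆))
    (b := (Subtype.val : B₀ → 𝕆)) (hr.symm ▸ hS)
  have hbb : SameType L A (Sum.elim b (Subtype.val : B₀ → 𝕆))
      (Sum.elim b' (Subtype.val : B₀ → 𝕆)) := by
    refine SameType.adjoin (hb.mono (Set.union_subset hAB ?_))
    simpa using hB₀
  let f : (ι ⊕ Fin k) ⊕ B₀ → ι ⊕ (Fin k ⊕ B₀) := Equiv.sumAssoc _ _ _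
  have := h.mem_iff ((hS'.preimage_comp f).mono (Set.empty_subset A)) hbb
  have aux : ∀ c : Fin k → 𝕆, ∀ x : ι → 𝕆,
      Sum.elim x (Sum.elim c (Subtype.val : B₀ → 𝕆)) ∘ f = Sum.elim (Sum.elim x c) Subtype.val := by
    intro c x
    funext i
    rcases i with (i | i) | i <;> rfl
  simpa only [Set.mem_preimage, aux, Set.mem_ofPred_eq, ← hx] using this

/-- Realizations of an invariant type over parameters of the same type have the same type jointly
with these parameters. -/
theorem InvariantUF.sameType_elim [Finite γ] {U : Ultrafilter (ι → 𝕆)} (hU : InvariantUF L U A)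
    {d d' : ι → 𝕆} {c c' : γ → 𝕆} (hd : RealizesUF L U (A ∪ Set.range c) d)
    (hd' : RealizesUF L U (A ∪ Set.range c') d') (hc : SameType L A c c') :
    SameType L A (Sum.elim d c) (Sum.elim d' c') := by
  intro S hS
  have h1 := hd _ (definable_fiber hS Set.subset_union_left Set.subset_union_right)
  have h2 := hd' _ (definable_fiber hS Set.subset_union_left Set.subset_union_right)
  exact h1.symm.trans ((hU.mem_iff hS hc).trans h2)

theorem InvariantUF.realizesUF_congr [Finite γ] {U : Ultrafilter (ι → 𝕆)} (hU : InvariantUF L U A)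
    {d d' : ι → 𝕆} {c c' : γ → 𝕆} (hd : RealizesUF L U (A ∪ Set.range c) d)
    (h : SameType L A (Sum.elim d c) (Sum.elim d' c')) :
    RealizesUF L U (A ∪ Set.range c') d' := by
  intro S hS
  obtain ⟨S', hS', hx⟩ := exists_definable_fiber_eq hS
  have hc : SameType L A c c' := by simpa using h.comp Sum.inr
  have h1 := hd _ (definable_fiber hS' Set.subset_union_left Set.subset_union_right)
  have h2 : S = {x | Sum.elim x c' ∈ S'} := Set.ext hx
  rw [h2]
  exact (hU.mem_iff hS' hc).symm.trans (h1.trans (h S' hS'))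

end Definability

/-! ### Translation between complete types and ultrafilters -/

section Representation

variable {L : FirstOrder.Language.{u, v}} {𝕆 : Type w} [L.Structure 𝕆] {A : Set 𝕆} {n : ℕ}

/-- The type `q` over `A` consists of the formulas that hold `U`-almost everywhere. -/
def Represents (U : Ultrafilter (Fin n → 𝕆)) (q : TypeOver L A n) : Prop :=
  ∀ ψ : L[[A]].Formula (Fin n), q.Has ψ ↔ {x | ψ.Realize x} ∈ U

/-- Validity in `𝕆` is expressed by a universal sentence of the complete theory, so the formula
holds of every tuple in every model of that theory. -/
theorem TypeOver.has_of_forall [Nonempty 𝕆] (q : TypeOver L A n) {ψ : L[[A]].Formula (Fin n)}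
    (h : ∀ x : Fin n → 𝕆, ψ.Realize x) : q.Has ψ := by
  refine q.mem_of_models ?_
  rw [← FirstOrder.Language.Theory.models_formula_iff_onTheory_models_equivSentence,
    FirstOrder.Language.Theory.models_formula_iff]
  intro K v
  have hs : (ψ.relabel Sum.inr : L[[A]].Formula (Empty ⊕ Fin n)).iAlls (Fin n) ∈
      L[[A]].completeTheory 𝕆 := by
    rw [FirstOrder.Language.mem_completeTheory]
    simp only [FirstOrder.Language.Sentence.Realize, FirstOrder.Language.Formula.realize_iAlls,
      FirstOrder.Language.Formula.realize_relabel, Sum.elim_comp_inr]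
    exact h
  have := K.is_model.realize_of_mem _ hs
  simp only [FirstOrder.Language.Sentence.Realize, FirstOrder.Language.Formula.realize_iAlls,
      FirstOrder.Language.Formula.realize_relabel, Sum.elim_comp_inr] at this
  exact this v

theorem TypeOver.has_not (q : TypeOver L A n) (ψ : L[[A]].Formula (Fin n)) :
    q.Has ψ.not ↔ ¬ q.Has ψ :=
  q.not_mem_iff (FirstOrder.Language.Formula.equivSentence ψ)

theorem TypeOver.has_inf (q : TypeOver L A n) {ψ χ : L[[A]].Formula (Fin n)}
    (h : q.Has ψ) (h' : q.Has χ) : q.Has (ψ ⊓ χ) := by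
  unfold TypeOver.Has at *
  rw [← SetLike.mem_coe, q.isMaximal.mem_iff_models,
    FirstOrder.Language.Theory.models_sentence_iff] at *
  intro K
  exact FirstOrder.Language.BoundedFormula.realize_inf.2 ⟨h K, h' K⟩

/-- The sets defined by formulas of `q` generate a filter, proper because the negation of a nowhere
satisfied formula belongs to `q`. An ultrafilter refining it adds no further definable sets, since
`q` is complete. -/
theorem TypeOver.exists_represents [Nonempty 𝕆] (q : TypeOver L A n) :
    ∃ U : Ultrafilter (Fin n → 𝕆), Represents U q := by
  let F : Filter (Fin n → 𝕆) :=
    { sets := {S | ∃ ψ : L[[A]].Formula (Fin n), q.Has ψ ∧ {x | ψ.Realize x} ⊆ S}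
      univ_sets := ⟨⊤, q.has_of_forall (by simp), Set.subset_univ _⟩
      sets_of_superset := fun ⟨ψ, h, h'⟩ hs => ⟨ψ, h, h'.trans hs⟩
      inter_sets := fun ⟨ψ, h, h'⟩ ⟨χ, k, k'⟩ => ⟨ψ ⊓ χ, q.has_inf h k, fun x hx =>
        ⟨h' (FirstOrder.Language.Formula.realize_inf.1 hx).1,
          k' (FirstOrder.Language.Formula.realize_inf.1 hx).2⟩⟩ }
  have hF : F.NeBot := by
    refine ⟨fun hb => ?_⟩
    have : (∅ : Set (Fin n → 𝕆)) ∈ F := by rw [hb]; trivial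
    obtain ⟨ψ, h, h'⟩ := this
    refine (q.has_not ψ).1 (q.has_of_forall fun x => ?_) h
    exact FirstOrder.Language.Formula.realize_not.2 fun hx => h' hx
  refine ⟨Ultrafilter.of F, fun ψ => ⟨fun h => Ultrafilter.of_le F ⟨ψ, h, subset_rfl⟩, fun h => ?_⟩⟩
  by_contra hn
  have h2 : {x | ψ.not.Realize x} ∈ Ultrafilter.of F :=
    Ultrafilter.of_le F ⟨ψ.not, (q.has_not ψ).2 hn, subset_rfl⟩
  obtain ⟨x, hx, hx'⟩ := Ultrafilter.nonempty_of_mem (Filter.inter_mem h h2)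
  exact FirstOrder.Language.Formula.realize_not.1 hx' hx

theorem has_tp_iff [Nonempty 𝕆] (a : Fin n → 𝕆) (ψ : L[[A]].Formula (Fin n)) :
    (tp A a : TypeOver L A n).Has ψ ↔ ψ.Realize a :=
  FirstOrder.Language.Theory.CompleteType.formula_mem_typeOf

/-- The type over `A` defined by an ultrafilter. -/
def ofUltrafilter [Nonempty 𝕆] (A : Set 𝕆) (U : Ultrafilter (Fin n → 𝕆)) : TypeOver L A n where
  toTheory := {σ | {x | σ ∈ (tp A x : TypeOver L A n)} ∈ U}
  subset' σ hσ := Filter.univ_mem' fun x => (tp A x : TypeOver L A n).subset hσ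
  isMaximal' := by
    constructor
    · rw [FirstOrder.Language.Theory.isSatisfiable_iff_isFinitelySatisfiable]
      intro T₀ hT₀
      have : (⋂ σ ∈ T₀, {x : Fin n → 𝕆 | σ ∈ (tp A x : TypeOver L A n)}) ∈ U :=
        (Filter.biInter_finset_mem _).2 fun σ hσ => hT₀ hσ
      obtain ⟨x, hx⟩ := Ultrafilter.nonempty_of_mem this
      refine (tp A x : TypeOver L A n).isMaximal.1.mono fun σ hσ => ?_
      exact Set.mem_iInter₂.1 hx σ hσ
    · intro σ
      change {x | σ ∈ (tp A x : TypeOver L A n)} ∈ U ∨ {x | σ.not ∈ (tp A x : TypeOver L A n)} ∈ U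
      rw [← Ultrafilter.union_mem_iff]
      exact Filter.univ_mem' fun x => (tp A x : TypeOver L A n).mem_or_not_mem σ

theorem represents_ofUltrafilter [Nonempty 𝕆] (A : Set 𝕆) (U : Ultrafilter (Fin n → 𝕆)) :
    Represents U (ofUltrafilter A U : TypeOver L A n) := by
  intro ψ
  have : {x : Fin n → 𝕆 | ψ.Realize x} = {x | (tp A x : TypeOver L A n).Has ψ} := by
    ext x
    exact (has_tp_iff x ψ).symm
  rw [this]
  rfl

theorem tp_eq_iff [Nonempty 𝕆] {a b : Fin n → 𝕆} :
    (tp A a : TypeOver L A n) = tp A b ↔ SameType L A a b := by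
  constructor
  · rintro h S ⟨ψ, rfl⟩
    change ψ.Realize a ↔ ψ.Realize b
    rw [← has_tp_iff, ← has_tp_iff, h]
  · intro h
    refine SetLike.ext fun σ => ?_
    obtain ⟨ψ, rfl⟩ := (FirstOrder.Language.Formula.equivSentence (L := L[[A]])).surjective σ
    change (tp A a : TypeOver L A n).Has ψ ↔ (tp A b : TypeOver L A n).Has ψ
    rw [has_tp_iff, has_tp_iff]
    exact h _ ⟨ψ, rfl⟩

variable {m : ℕ} {U : Ultrafilter (Fin m → 𝕆)} {q : GlobalType L 𝕆 m}

theorem Represents.has_lift (h : Represents U q) {C : Set 𝕆} (ψ : L[[C]].Formula (Fin m)) :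
    q.Has (lift (Set.subset_univ C) ψ) ↔ {x | ψ.Realize x} ∈ U := by
  rw [h]
  simp only [realize_lift]

theorem Represents.has_plug (h : Represents U q) {k : ℕ} {C : Set 𝕆}
    (φ : L[[C]].Formula (Fin m ⊕ Fin k)) (b : Fin k → 𝕆) :
    q.Has (plug (lift (Set.subset_univ C) φ) fun j => ⟨b j, trivial⟩) ↔
      {x | φ.Realize (Sum.elim x b)} ∈ U := by
  rw [h]
  simp only [realize_plug, realize_lift]

theorem Represents.realizesRestriction_iff (h : Represents U q) {C : Set 𝕆} {a : Fin m → 𝕆} :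
    RealizesRestriction q C a ↔ RealizesUF L U C a := by
  constructor
  · rintro hq S ⟨ψ, rfl⟩
    exact (h.has_lift ψ).symm.trans (hq ψ)
  · intro hU ψ
    exact (h.has_lift ψ).trans (hU _ ⟨ψ, rfl⟩)

theorem Represents.isInvariant_iff [Nonempty 𝕆] (h : Represents U q) :
    IsInvariant q A ↔ InvariantUF L U A := by
  constructor
  · rintro hq k S ⟨φ, rfl⟩ b b' hb
    exact (h.has_plug φ b).symm.trans ((hq k φ b b' (tp_eq_iff.2 hb)).trans (h.has_plug φ b'))
  · intro hU k φ b b' hb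
    exact (h.has_plug φ b).trans
      ((hU k _ ⟨φ, rfl⟩ b b' (tp_eq_iff.1 hb)).trans (h.has_plug φ b').symm)

theorem invariantlyIndep_iff [Nonempty 𝕆] {C : Set 𝕆} {d : Fin m → 𝕆} :
    InvariantlyIndep L A C d ↔
      ∃ U : Ultrafilter (Fin m → 𝕆), InvariantUF L U A ∧ RealizesUF L U C d := by
  constructor
  · rintro ⟨q, hq, hd⟩
    obtain ⟨U, hU⟩ := q.exists_represents
    exact ⟨U, hU.isInvariant_iff.1 hq, hU.realizesRestriction_iff.1 hd⟩
  · rintro ⟨U, hU, hd⟩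
    have h := represents_ofUltrafilter (L := L) Set.univ U
    exact ⟨_, h.isInvariant_iff.2 hU, h.realizesRestriction_iff.2 hd⟩

theorem IsSaturated.exists_realizesUF [Nonempty 𝕆] {κ : Cardinal.{w}} (h : IsSaturated L κ 𝕆)
    (U : Ultrafilter (Fin n → 𝕆)) (hA : Cardinal.mk A < κ) : ∃ a, RealizesUF L U A a := by
  obtain ⟨a, ha⟩ := h A hA n (ofUltrafilter A U)
  refine ⟨a, ?_⟩
  rintro S ⟨ψ, rfl⟩
  rw [← represents_ofUltrafilter (L := L) A U ψ, ← ha, has_tp_iff]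
  rfl

theorem IsSaturated.mono [Nonempty 𝕆] {κ μ : Cardinal.{w}} (h : IsSaturated L κ 𝕆) (hμ : μ ≤ κ) :
    IsSaturated L μ 𝕆 := fun A hA n p => h A (hA.trans_le hμ) n p

end Representation

/-! ### Finite Morley sequences and their types -/

section Morley

variable {L : FirstOrder.Language.{u, v}} {𝕆 : Type w} [L.Structure 𝕆] {A B C : Set 𝕆} {m : ℕ}
  {U : Ultrafilter (Fin m → 𝕆)}

/-- The entries of the first `r` members of a sequence of tuples. -/
def entries (r : ℕ) (e : ℕ → Fin m → 𝕆) : Set 𝕆 := ⋃ j, ⋃ (_ : j < r), Set.range (e j)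

/-- The first `r` members of a sequence of tuples, as one tuple. -/
def initial (r : ℕ) (e : ℕ → Fin m → 𝕆) : Fin r × Fin m → 𝕆 := fun ij => e ij.1 ij.2

/-- The first `r` members of `e` form a Morley sequence over `C` in the type defined by `U`. -/
def MorleyUF (L : FirstOrder.Language.{u, v}) {𝕆 : Type w} [L.Structure 𝕆] {m : ℕ}
    (U : Ultrafilter (Fin m → 𝕆)) (C : Set 𝕆) (r : ℕ) (e : ℕ → Fin m → 𝕆) : Prop :=
  ∀ i < r, RealizesUF L U (C ∪ entries i e) (e i)

theorem mem_entries {r : ℕ} {e : ℕ → Fin m → 𝕆} {x : 𝕆} :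
    x ∈ entries r e ↔ ∃ j < r, ∃ i, e j i = x := by
  simp [entries]

theorem range_initial (r : ℕ) (e : ℕ → Fin m → 𝕆) : Set.range (initial r e) = entries r e := by
  ext x
  rw [mem_entries]
  constructor
  · rintro ⟨⟨j, i⟩, rfl⟩
    exact ⟨j, j.2, i, rfl⟩
  · rintro ⟨j, hj, i, rfl⟩
    exact ⟨(⟨j, hj⟩, i), rfl⟩

theorem finite_entries (r : ℕ) (e : ℕ → Fin m → 𝕆) : (entries r e).Finite := by
  rw [← range_initial]
  exact Set.finite_range _

theorem entries_mono {r s : ℕ} (h : r ≤ s) (e : ℕ → Fin m → 𝕆) : entries r e ⊆ entries s e := by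
  intro x
  simp only [mem_entries]
  rintro ⟨j, hj, i, hx⟩
  exact ⟨j, hj.trans_le h, i, hx⟩

theorem MorleyUF.mono {r s : ℕ} {e : ℕ → Fin m → 𝕆} (h : MorleyUF L U C s e) (hBC : B ⊆ C)
    (hrs : r ≤ s) : MorleyUF L U B r e :=
  fun i hi => (h i (hi.trans_le hrs)).mono (Set.union_subset_union_left _ hBC)

theorem MorleyUF.congr {r : ℕ} {e e' : ℕ → Fin m → 𝕆} (h : MorleyUF L U C r e)
    (hee : ∀ i < r, e i = e' i) : MorleyUF L U C r e' := by
  intro i hi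
  have : entries i e' = entries i e := by
    ext x
    simp only [mem_entries]
    exact exists_congr fun j => and_congr_right fun hj => by rw [hee j (hj.trans hi)]
  rw [this, ← hee i hi]
  exact h i hi

/-- The members of `Fin (r + 1) × Fin m` as the last block and the previous ones. -/
def splitLast (r m : ℕ) : Fin (r + 1) × Fin m → Fin m ⊕ (Fin r × Fin m) :=
  fun ij => if h : (ij.1 : ℕ) < r then Sum.inr (⟨ij.1, h⟩, ij.2) else Sum.inl ij.2

theorem elim_comp_splitLast (r : ℕ) (e : ℕ → Fin m → 𝕆) :
    Sum.elim (e r) (initial r e) ∘ splitLast r m = initial (r + 1) e := by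
  funext ⟨j, i⟩
  by_cases h : (j : ℕ) < r
  · simp [splitLast, h, initial]
  · have : (j : ℕ) = r := by have := j.2; omega
    simp [splitLast, initial, this]

/-- Morley sequences of the same length in an invariant type, over parameters of the same type,
have the same type. -/
theorem MorleyUF.sameType {γ : Type*} [Finite γ] (hU : InvariantUF L U A) {c c' : γ → 𝕆}
    (hc : SameType L A c c') {r : ℕ} {e e' : ℕ → Fin m → 𝕆}
    (he : MorleyUF L U (A ∪ Set.range c) r e) (he' : MorleyUF L U (A ∪ Set.range c') r e') :
    SameType L A (Sum.elim (initial r e) c) (Sum.elim (initial r e') c') := by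
  induction r with
  | zero =>
    have key : ∀ (f : ℕ → Fin m → 𝕆) (d : γ → 𝕆), Sum.elim (initial 0 f) d =
        d ∘ (Sum.elim (fun i : Fin 0 × Fin m => i.1.elim0) id) := by
      intro f d
      funext i
      rcases i with i | i
      · exact i.1.elim0
      · rfl
    rw [key, key]
    exact hc.comp _
  | succ r ih =>
    have h0 := ih (he.mono subset_rfl r.le_succ) (he'.mono subset_rfl r.le_succ)
    have hr : ∀ (f : ℕ → Fin m → 𝕆) (d : γ → 𝕆), A ∪ Set.range (Sum.elim (initial r f) d) =
        A ∪ Set.range d ∪ entries r f := by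
      intro f d
      rw [Set.Sum.elim_range, range_initial, Set.union_assoc, Set.union_comm (entries r f)]
    have h1 := hU.sameType_elim (d := e r) (d' := e' r)
      (by rw [hr]; exact he r r.lt_succ_self) (by rw [hr]; exact he' r r.lt_succ_self) h0
    have key : ∀ (f : ℕ → Fin m → 𝕆) (d : γ → 𝕆), Sum.elim (initial (r + 1) f) d =
        Sum.elim (f r) (Sum.elim (initial r f) d) ∘
          Sum.elim (fun ij => (splitLast r m ij).elim Sum.inl fun x => Sum.inr (Sum.inl x))
            fun i => Sum.inr (Sum.inr i) := by
      intro f d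
      rw [← elim_comp_splitLast]
      funext i
      rcases i with i | i
      · simp only [Sum.elim_inl, Function.comp]
        rcases splitLast r m i with j | j <;> rfl
      · rfl
    rw [key, key]
    exact h1.comp _

/-- At stage `i`, the parameters `c` together with the first `i` members form one finite tuple, and
`InvariantUF.realizesUF_congr` transfers the realization of `U` over it. -/
theorem MorleyUF.of_sameType {γ : Type*} [Finite γ] (hU : InvariantUF L U A) {c c' : γ → 𝕆}
    {r : ℕ} {e e' : ℕ → Fin m → 𝕆} (he : MorleyUF L U (A ∪ Set.range c) r e)
    (h : SameType L A (Sum.elim (initial r e) c) (Sum.elim (initial r e') c')) :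
    MorleyUF L U (A ∪ Set.range c') r e' := by
  intro i hi
  have hr : ∀ (f : ℕ → Fin m → 𝕆) (d : γ → 𝕆), A ∪ Set.range (Sum.elim (initial i f) d) =
      A ∪ Set.range d ∪ entries i f := by
    intro f d
    rw [Set.Sum.elim_range, range_initial, Set.union_assoc, Set.union_comm (entries i f)]
  rw [← hr]
  refine hU.realizesUF_congr (c := Sum.elim (initial i e) c) (d := e i)
    (by rw [hr]; exact he i hi) ?_
  have key : ∀ (f : ℕ → Fin m → 𝕆) (d : γ → 𝕆),
      Sum.elim (f i) (Sum.elim (initial i f) d) = Sum.elim (initial r f) d ∘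
        Sum.elim (fun j => Sum.inl (⟨i, hi⟩, j))
          (Sum.elim (fun jk => Sum.inl (⟨jk.1, jk.1.2.trans hi⟩, jk.2)) Sum.inr) := by
    intro f d
    funext x
    rcases x with x | x | x <;> rfl
  rw [key, key]
  exact h.comp _

theorem Represents.isMorleySequence_iff {q : GlobalType L 𝕆 m} (h : Represents U q)
    {e : ℕ → Fin m → 𝕆} : IsMorleySequence q A e ↔ ∀ r, MorleyUF L U A r e := by
  constructor
  · intro hq r i _
    exact h.realizesRestriction_iff.1 (hq i)
  · intro hU i
    exact h.realizesRestriction_iff.2 (hU (i + 1) i i.lt_succ_self)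

theorem Represents.realizesPower_iff {q : GlobalType L 𝕆 m} (h : Represents U q) {r : ℕ}
    {e : ℕ → Fin m → 𝕆} :
    RealizesPower q A (fun i : Fin r => e i) ↔ MorleyUF L U A r e := by
  have key : ∀ i : Fin r, (⋃ j, ⋃ (_ : j < i), Set.range (e j)) = entries i e := by
    intro i
    ext x
    simp only [mem_entries, Set.mem_iUnion, Set.mem_range, exists_prop]
    constructor
    · rintro ⟨j, hj, hx⟩
      exact ⟨j, hj, hx⟩
    · rintro ⟨j, hj, hx⟩
      exact ⟨⟨j, hj.trans i.2⟩, hj, hx⟩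
  constructor
  · intro hq i hi
    have := h.realizesRestriction_iff.1 (hq ⟨i, hi⟩)
    rwa [key] at this
  · intro hU i
    rw [key]
    exact h.realizesRestriction_iff.2 (hU i i.2)

end Morley

/-! ### Ramsey theorems for the binary tree -/

section TreeRamsey

/-- Embeddings of the binary tree preserving and reflecting the initial segment relation. -/
def IsTreeEmb (e : List Bool → List Bool) : Prop := ∀ σ τ, e σ <+: e τ ↔ σ <+: τ

theorem prefix_or_split : ∀ σ τ : List Bool,
    σ <+: τ ∨ τ <+: σ ∨ ∃ ρ i, ρ ++ [i] <+: σ ∧ ρ ++ [!i] <+: τ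
  | [], _ => Or.inl List.nil_prefix
  | _ :: _, [] => Or.inr (Or.inl List.nil_prefix)
  | i :: σ, j :: τ => by
    by_cases h : i = j
    · subst h
      rcases prefix_or_split σ τ with h | h | ⟨ρ, k, h, h'⟩
      · exact Or.inl (by simpa using h)
      · exact Or.inr (Or.inl (by simpa using h))
      · exact Or.inr (Or.inr ⟨i :: ρ, k, by simpa using h, by simpa using h'⟩)
    · have hj : j = !i := by cases i <;> cases j <;> simp_all
      exact Or.inr (Or.inr ⟨[], i, by simp, by simp [hj]⟩)

/-- The hypothesis keeps left and right successors on their sides. Nodes that split at `ρ` therefore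
have images that split at `e ρ`, which is why the order is reflected. -/
theorem isTreeEmb_of_append {e : List Bool → List Bool} (h : ∀ τ i, e τ ++ [i] <+: e (τ ++ [i])) :
    IsTreeEmb e := by
  have mono : ∀ σ ρ, e σ <+: e (σ ++ ρ) := by
    intro σ ρ
    induction ρ using List.reverseRecOn with
    | nil => simp
    | append_singleton ρ i ih =>
      rw [← List.append_assoc]
      exact ih.trans ((List.prefix_append _ _).trans (h _ i))
  have mono' : ∀ σ τ, σ <+: τ → e σ <+: e τ := by
    rintro σ _ ⟨ρ, rfl⟩
    exact mono σ ρ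
  intro σ τ
  refine ⟨fun hst => ?_, mono' σ τ⟩
  rcases prefix_or_split σ τ with h1 | ⟨ρ, rfl⟩ | ⟨ρ, i, h1, h2⟩
  · exact h1
  · rcases ρ with _ | ⟨i, ρ⟩
    · simp
    · have h3 : e τ ++ [i] <+: e τ := by
        refine ((h τ i).trans (mono' _ _ ?_)).trans hst
        exact ⟨ρ, by simp⟩
      simpa using h3.length_le
  · have h3 : e ρ ++ [i] <+: e τ := ((h ρ i).trans (mono' _ _ h1)).trans hst
    have h4 : e ρ ++ [!i] <+: e τ := (h ρ !i).trans (mono' _ _ h2)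
    have h5 := (List.prefix_of_prefix_length_le h3 h4 (by simp)).eq_of_length (by simp)
    simp at h5

/-- If no color were dense in any cone, one could pass to smaller cones that avoid the colors one
after another, and finitely many steps would leave none. -/
theorem exists_dense_color {γ : Type*} [Finite γ] (χ : List Bool → γ) :
    ∃ c σ, ∀ τ, ∃ ρ, χ (σ ++ τ ++ ρ) = c := by
  classical
  by_contra! hcon
  have key : ∀ s : Finset γ, ∃ σ, ∀ ρ, χ (σ ++ ρ) ∉ s := by
    intro s
    induction s using Finset.induction_on with
    | empty => exact ⟨[], by simp⟩
    | insert c s _ ih =>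
      obtain ⟨σ, hσ⟩ := ih
      obtain ⟨τ, hτ⟩ := hcon c σ
      refine ⟨σ ++ τ, fun ρ => ?_⟩
      rw [Finset.mem_insert, not_or]
      refine ⟨hτ ρ, ?_⟩
      rw [List.append_assoc]
      exact hσ _
  have := Fintype.ofFinite γ
  obtain ⟨σ, hσ⟩ := key Finset.univ
  exact hσ [] (Finset.mem_univ _)

/-- Above a node where `c` is dense, every successor can be extended further to a node of color `c`;
iterating this defines the embedding. -/
theorem exists_monochromatic {γ : Type*} [Finite γ] (χ : List Bool → γ) :
    ∃ c e, IsTreeEmb e ∧ ∀ σ, χ (e σ) = c := by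
  obtain ⟨c, σ, h⟩ := exists_dense_color χ
  choose ext hext using h
  -- Recursion on lists peels off the head, whereas the tree grows at the end of the list; hence `g`
  -- takes the reversed node.
  let g : List Bool → List Bool :=
    fun t => t.rec (ext []) fun i _ r => r ++ [i] ++ ext (r ++ [i])
  have g_cons : ∀ i t, g (i :: t) = g t ++ [i] ++ ext (g t ++ [i]) := fun _ _ => rfl
  refine ⟨c, fun τ => σ ++ g τ.reverse, isTreeEmb_of_append fun τ i => ?_, fun τ => ?_⟩
  · simp only [List.reverse_append, List.reverse_cons, List.reverse_nil, List.nil_append,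
      List.singleton_append, g_cons]
    exact ⟨ext (g τ.reverse ++ [i]), by simp⟩
  · change χ (σ ++ g τ.reverse) = c
    rcases τ.reverse with _ | ⟨i, t⟩
    · simpa using hext []
    · rw [g_cons, ← List.append_assoc]
      exact hext _

section Pairs

variable {γ : Type*} [Finite γ] (f : List Bool → List Bool → γ)

theorem exists_step (e : List Bool → List Bool) :
    ∃ c s, IsTreeEmb s ∧ ∀ σ, f (e []) (e (s σ)) = c := exists_monochromatic fun σ => f (e []) (e σ)

/-- The color that the root of the tree `e` has with almost all nodes above it. -/
noncomputable def rootColor (e : List Bool → List Bool) : γ := (exists_step f e).choose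

/-- A subtree on which all pairs with the root of `e` have the same color. -/
noncomputable def rootStep (e : List Bool → List Bool) : List Bool → List Bool :=
  (exists_step f e).choose_spec.choose

theorem rootStep_emb (e : List Bool → List Bool) : IsTreeEmb (rootStep f e) :=
  (exists_step f e).choose_spec.choose_spec.1

theorem rootStep_color (e : List Bool → List Bool) (σ : List Bool) :
    f (e []) (e (rootStep f e σ)) = rootColor f e :=
  (exists_step f e).choose_spec.choose_spec.2 σ

/-- A subtree on which the color of a pair depends only on its lower member. -/
noncomputable def endHomogeneous (e : List Bool → List Bool) : List Bool → List Bool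
  | [] => e []
  | i :: η => endHomogeneous (fun ρ => e (rootStep f e (i :: ρ))) η

/-- The color of the pairs with a given lower member in `endHomogeneous`. -/
noncomputable def endColor (e : List Bool → List Bool) : List Bool → γ
  | [] => rootColor f e
  | i :: η => endColor (fun ρ => e (rootStep f e (i :: ρ))) η

theorem endHomogeneous_mem : ∀ (e : List Bool → List Bool) (η : List Bool),
    ∃ y, endHomogeneous f e η = e y
  | e, [] => ⟨[], rfl⟩
  | e, i :: η => by
    obtain ⟨y, hy⟩ := endHomogeneous_mem (fun ρ => e (rootStep f e (i :: ρ))) η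
    exact ⟨_, hy⟩

theorem endHomogeneous_cons_mem (e : List Bool → List Bool) (i : Bool) (η : List Bool) :
    ∃ y, endHomogeneous f e (i :: η) = e (rootStep f e (i :: y)) :=
  endHomogeneous_mem f (fun ρ => e (rootStep f e (i :: ρ))) η

/-- Below the root, the construction continues separately inside the two cones over the successors
in the subtree `rootStep`, so different first letters give incomparable images. -/
theorem endHomogeneous_emb : ∀ (σ τ : List Bool) (e : List Bool → List Bool), IsTreeEmb e →
    (endHomogeneous f e σ <+: endHomogeneous f e τ ↔ σ <+: τ)
  | [], τ, e, he => by
    obtain ⟨y, hy⟩ := endHomogeneous_mem f e τ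
    rw [hy]
    exact iff_of_true ((he _ _).2 List.nil_prefix) List.nil_prefix
  | i :: σ, [], e, he => by
    obtain ⟨y, hy⟩ := endHomogeneous_cons_mem f e i σ
    rw [hy]
    refine iff_of_false (fun h => ?_) (by simp)
    have h1 := (he _ _).1 h
    have h2 := (rootStep_emb f e _ _).1 (h1.trans (List.nil_prefix (l := rootStep f e [])))
    simp at h2
  | i :: σ, j :: τ, e, he => by
    by_cases hij : i = j
    · subst hij
      have he' : IsTreeEmb fun ρ => e (rootStep f e (i :: ρ)) := by
        intro a b
        rw [he, rootStep_emb f e]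
        simp
      have := endHomogeneous_emb σ τ _ he'
      simpa [endHomogeneous] using this
    · obtain ⟨y, hy⟩ := endHomogeneous_cons_mem f e i σ
      obtain ⟨z, hz⟩ := endHomogeneous_cons_mem f e j τ
      rw [hy, hz, he, rootStep_emb f e]
      simp [hij]

theorem endHomogeneous_color : ∀ (σ τ : List Bool) (e : List Bool → List Bool), σ <+: τ → σ ≠ τ →
    f (endHomogeneous f e σ) (endHomogeneous f e τ) = endColor f e σ
  | [], [], _, _, h => absurd rfl h
  | [], j :: τ, e, _, _ => by
    obtain ⟨y, hy⟩ := endHomogeneous_cons_mem f e j τ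
    rw [hy]
    exact rootStep_color f e _
  | i :: σ, [], e, h, _ => by simp at h
  | i :: σ, j :: τ, e, h, h' => by
    obtain ⟨rfl, hστ⟩ : i = j ∧ σ <+: τ := by simpa using h
    exact endHomogeneous_color σ τ _ hστ (by simpa using h')

/-- Ramsey's theorem for pairs of comparable nodes of the binary tree. -/
theorem exists_pair_homogeneous :
    ∃ c g, IsTreeEmb g ∧ ∀ σ τ, σ <+: τ → σ ≠ τ → f (g σ) (g τ) = c := by
  obtain ⟨c, e, he, hc⟩ := exists_monochromatic (endColor f id)
  refine ⟨c, fun σ => endHomogeneous f id (e σ), fun σ τ => ?_, fun σ τ h h' => ?_⟩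
  · rw [endHomogeneous_emb f _ _ id fun _ _ => Iff.rfl, he]
  · rw [endHomogeneous_color f _ _ id ((he _ _).2 h), hc]
    intro heq
    have h1 := (he τ σ).1 (by rw [heq])
    exact h' (h.eq_of_length (le_antisymm h.length_le h1.length_le))

end Pairs

end TreeRamsey

/-! ### Consistency patterns and compactness -/

section Patterns

variable {L : FirstOrder.Language.{u, v}} {T : L.Theory}

/-- The set of formulas `φ(x, b i)`, `i ∈ P`, is consistent. -/
def Con {K : Type*} [L.Structure K] {n : ℕ} {ι I : Type*} (φ : L.Formula (Fin n ⊕ ι))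
    (b : I → ι → K) (P : Finset I) : Prop :=
  ∃ x : Fin n → K, ∀ i ∈ P, φ.Realize (Sum.elim x (b i))

theorem Con.mono {K : Type*} [L.Structure K] {n : ℕ} {ι I : Type*} {φ : L.Formula (Fin n ⊕ ι)}
    {b : I → ι → K} {P Q : Finset I} (h : Con φ b Q) (hPQ : P ⊆ Q) : Con φ b P :=
  h.imp fun _ hx i hi => hx i (hPQ hi)

theorem con_image {K : Type*} [L.Structure K] {n : ℕ} {ι I I' : Type*} [DecidableEq I]
    {φ : L.Formula (Fin n ⊕ ι)} {b : I → ι → K} {P : Finset I'} {g : I' → I} :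
    Con φ b (P.image g) ↔ Con φ (fun i => b (g i)) P := by
  simp [Con]

/-- Conjunctions of instances have variables indexed by sums and products of finite types;
reindexing brings them to the form in `HasATP`. -/
theorem hasATP_of_finite {K : FirstOrder.Language.Theory.ModelType.{u, v, w} T} {n : ℕ} {ι : Type*}
    [Finite ι] (φ : L.Formula (Fin n ⊕ ι)) (b : List Bool → ι → K)
    (h : ∀ P : Finset (List Bool), IsAntichain (fun σ τ => σ <+: τ) (P : Set (List Bool)) →
      Con φ b P)
    (h' : ∀ σ τ, σ <+: τ → σ ≠ τ → ¬ Con φ b {σ, τ}) : HasATP.{u, v, w} T := by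
  obtain ⟨m, ⟨e⟩⟩ := Finite.exists_equiv_fin ι
  have key : ∀ σ x, (φ.relabel (Sum.map id e)).Realize (Sum.elim x (b σ ∘ e.symm)) ↔
      φ.Realize (Sum.elim x (b σ)) := by
    intro σ x
    rw [FirstOrder.Language.Formula.realize_relabel]
    have : Sum.elim x (b σ ∘ e.symm) ∘ Sum.map id e = Sum.elim x (b σ) := by
      funext i
      rcases i with i | i <;> simp
    rw [this]
  refine ⟨K, n, m, φ.relabel (Sum.map id e), fun σ => b σ ∘ e.symm, fun X hX s hs => ?_,
    fun σ τ hst hne ⟨x, h1, h2⟩ => ?_⟩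
  · obtain ⟨x, hx⟩ := h s (hX.subset hs)
    exact ⟨x, fun i hi => (key i x).2 (hx i hi)⟩
  · refine h' σ τ hst hne ⟨x, fun i hi => ?_⟩
    rcases Finset.mem_insert.1 hi with rfl | hi
    · exact (key _ x).1 h1
    · rw [Finset.mem_singleton.1 hi]
      exact (key _ x).1 h2

/-- The formula, in variables for `b`, expressing consistency of `φ(x, b i)` for `i ∈ P`. -/
noncomputable def conFormula {n : ℕ} {ι I : Type*} (φ : L.Formula (Fin n ⊕ ι)) (P : Finset I) :
    L.Formula (I × ι) :=
  (FirstOrder.Language.Formula.iInf fun i : P =>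
    φ.relabel (Sum.elim Sum.inr fun j => Sum.inl (i.1, j))).iExs (Fin n)

theorem realize_conFormula {K : Type*} [L.Structure K] {n : ℕ} {ι I : Type*}
    {φ : L.Formula (Fin n ⊕ ι)} {P : Finset I} {v : I × ι → K} :
    (conFormula φ P).Realize v ↔ Con φ (fun i j => v (i, j)) P := by
  rw [conFormula, FirstOrder.Language.Formula.realize_iExs]
  refine exists_congr fun x => ?_
  rw [FirstOrder.Language.Formula.realize_iInf]
  simp only [FirstOrder.Language.Formula.realize_relabel, Subtype.forall]
  refine forall₂_congr fun i _ => ?_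
  have : Sum.elim v x ∘ (Sum.elim Sum.inr fun j => Sum.inl (i, j)) =
      Sum.elim x fun j => v (i, j) := by
    funext k
    rcases k with k | k <;> rfl
  rw [this]

/-- Compactness for patterns of consistency and inconsistency. -/
theorem exists_pattern_of_finite {n : ℕ} {ι I : Type} (φ : L.Formula (Fin n ⊕ ι))
    (Pos Neg : Set (Finset I))
    (h : ∀ J : Finset I, ∃ (K : FirstOrder.Language.Theory.ModelType.{u, v, max u v w} T)
      (b : I → ι → K), (∀ P ∈ Pos, P ⊆ J → Con φ b P) ∧ ∀ P ∈ Neg, P ⊆ J → ¬ Con φ b P) :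
    ∃ (K : FirstOrder.Language.Theory.ModelType.{u, v, max u v w} T)
      (b : I → ι → K), (∀ P ∈ Pos, Con φ b P) ∧ ∀ P ∈ Neg, ¬ Con φ b P := by
  classical
  let sen : L.Formula (I × ι) → L[[I × ι]].Sentence := FirstOrder.Language.Formula.equivSentence
  let S : Finset I → L[[I × ι]].Theory := fun J =>
    (L.lhomWithConstants (I × ι)).onTheory T ∪
      ({σ | ∃ P ∈ Pos, P ⊆ J ∧ sen (conFormula φ P) = σ} ∪
        {σ | ∃ P ∈ Neg, P ⊆ J ∧ sen (conFormula φ P).not = σ})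
  have hdir : Directed (· ⊆ ·) S := by
    refine directed_of_isDirected_le fun J J' hJ => ?_
    refine Set.union_subset_union_right _ (Set.union_subset_union ?_ ?_)
    · rintro _ ⟨P, hP, hPJ, rfl⟩
      exact ⟨P, hP, hPJ.trans hJ, rfl⟩
    · rintro _ ⟨P, hP, hPJ, rfl⟩
      exact ⟨P, hP, hPJ.trans hJ, rfl⟩
  have hsat : FirstOrder.Language.Theory.IsSatisfiable (⋃ J, S J) := by
    rw [FirstOrder.Language.Theory.isSatisfiable_directed_union_iff hdir]
    intro J
    obtain ⟨K, b, h1, h2⟩ := h J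
    let _ : (FirstOrder.Language.constantsOn (I × ι)).Structure K :=
      FirstOrder.Language.constantsOn.structure fun ij => b ij.1 ij.2
    have real : ∀ θ : L.Formula (I × ι), (sen θ).Realize K ↔ θ.Realize fun ij => b ij.1 ij.2 :=
      fun θ => FirstOrder.Language.Formula.realize_equivSentence K θ
    have : K ⊨ S J := by
      rw [FirstOrder.Language.Theory.model_iff]
      rintro σ (hσ | ⟨P, hP, hPJ, rfl⟩ | ⟨P, hP, hPJ, rfl⟩)
      · have : K ⊨ (L.lhomWithConstants (I × ι)).onTheory T :=
          (FirstOrder.Language.LHom.onTheory_model _ _).2 K.is_model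
        exact this.realize_of_mem σ hσ
      · exact (real _).2 (realize_conFormula.2 (h1 P hP hPJ))
      · refine (real _).2 ?_
        rw [FirstOrder.Language.Formula.realize_not, realize_conFormula]
        exact h2 P hP hPJ
    exact FirstOrder.Language.Theory.Model.isSatisfiable K
  obtain ⟨K₀⟩ := hsat
  -- Satisfiability supplies a model in its own fixed universe, which is lifted to the one in the
  -- conclusion.
  let K := FirstOrder.Language.Theory.ModelType.ulift.{_, _, _, max u v w} K₀
  let _ : L.Structure K := (L.lhomWithConstants (I × ι)).reduct K
  have hT : K ⊨ T := by
    rw [← FirstOrder.Language.LHom.onTheory_model (L.lhomWithConstants (I × ι)),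
      FirstOrder.Language.Theory.model_iff]
    intro σ hσ
    exact K.is_model.realize_of_mem σ (Set.mem_iUnion.2 ⟨∅, Or.inl hσ⟩)
  have real : ∀ θ : L.Formula (I × ι), (sen θ).Realize K ↔
      θ.Realize fun ij => ((L.con ij : L[[I × ι]].Constants) : K) :=
    fun θ => FirstOrder.Language.Formula.realize_equivSentence K θ
  refine ⟨FirstOrder.Language.Theory.ModelType.of T K,
    fun i j => ((L.con (i, j) : L[[I × ι]].Constants) : K), fun P hP => ?_, fun P hP => ?_⟩
  · refine realize_conFormula.1 ((real _).1 ?_)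
    exact K.is_model.realize_of_mem _
      (Set.mem_iUnion.2 ⟨P, Or.inr (Or.inl ⟨P, hP, subset_rfl, rfl⟩)⟩)
  · intro hc
    have h1 := (real _).1 (K.is_model.realize_of_mem _
      (Set.mem_iUnion.2 ⟨P, Or.inr (Or.inr ⟨P, hP, subset_rfl, rfl⟩)⟩))
    exact FirstOrder.Language.Formula.realize_not.1 h1 (realize_conFormula.2 hc)

end Patterns

/-! ### From inconsistent long chains to inconsistent pairs -/

section Fattening

variable {L : FirstOrder.Language.{u, v}} {T : L.Theory}

/-- `T` has a binary tree of parameters for which antichains are consistent with `φ`, while chains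
of `k` nodes are not. -/
def TreePattern (T : L.Theory) {n : ℕ} {ι : Type} (φ : L.Formula (Fin n ⊕ ι)) (k : ℕ) : Prop :=
  ∃ (K : FirstOrder.Language.Theory.ModelType.{u, v, w} T) (b : List Bool → ι → K),
    (∀ P : Finset (List Bool), IsAntichain (fun σ τ => σ <+: τ) (P : Set (List Bool)) →
      Con φ b P) ∧
    ∀ P : Finset (List Bool), (∀ σ ∈ P, ∀ τ ∈ P, σ <+: τ ∨ τ <+: σ) → k ≤ P.card → ¬ Con φ b P

/-- Members of a tree in which the nodes in `F` carry two parameters, and the other ones one. -/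
def Active (F : Set (List Bool)) (p : List Bool × Bool) : Prop := p.2 = true → p.1 ∈ F

/-- Distinct nodes occurring in `P` are incomparable. -/
def Spread (P : Finset (List Bool × Bool)) : Prop := ∀ p ∈ P, ∀ q ∈ P, p.1 <+: q.1 → p.1 = q.1

/-- The nodes occurring in `P` are comparable. -/
def Linear (P : Finset (List Bool × Bool)) : Prop := ∀ p ∈ P, ∀ q ∈ P, p.1 <+: q.1 ∨ q.1 <+: p.1

/-- Like `TreePattern`, for trees in which the nodes in `F` carry two parameters. -/
def FatPattern (T : L.Theory) {n : ℕ} {ι : Type} (φ : L.Formula (Fin n ⊕ ι))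
    (F : Set (List Bool)) (k : ℕ) : Prop :=
  ∃ (K : FirstOrder.Language.Theory.ModelType.{u, v, w} T) (b : List Bool × Bool → ι → K),
    (∀ P, (∀ p ∈ P, Active F p) → Spread P → Con φ b P) ∧
    ∀ P, (∀ p ∈ P, Active F p) → Linear P → k ≤ P.card → ¬ Con φ b P

theorem TreePattern.fatPattern {n : ℕ} {ι : Type} {φ : L.Formula (Fin n ⊕ ι)} {k : ℕ}
    (h : TreePattern.{u, v, w} T φ k) : FatPattern.{u, v, w} T φ ∅ k := by
  classical
  obtain ⟨K, b, h1, h2⟩ := h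
  refine ⟨K, fun p => b p.1, fun P _ hs => ?_, fun P ha hl hk => ?_⟩
  · refine con_image.1 (h1 (P.image Prod.fst) ?_)
    intro σ hσ τ hτ hne hp
    simp only [Finset.coe_image, Set.mem_image, Finset.mem_coe] at hσ hτ
    obtain ⟨p, hp', rfl⟩ := hσ
    obtain ⟨q, hq', rfl⟩ := hτ
    exact hne (hs p hp' q hq' hp)
  · have hinj : Set.InjOn Prod.fst (P : Set (List Bool × Bool)) := by
      rintro ⟨σ, i⟩ hp ⟨τ, j⟩ hq h
      have hi := ha _ hp
      have hj := ha _ hq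
      simp only [Active, Set.mem_empty_iff_false, imp_false, Bool.not_eq_true] at hi hj
      simp_all
    refine mt con_image.2 (h2 (P.image Prod.fst) ?_ ?_)
    · intro σ hσ τ hτ
      obtain ⟨p, hp', rfl⟩ := Finset.mem_image.1 hσ
      obtain ⟨q, hq', rfl⟩ := Finset.mem_image.1 hτ
      exact hl p hp' q hq'
    · rwa [Finset.card_image_of_injOn hinj]

/-- The embedding moving the cone above `η` to the cone above `u`. -/
def moveCone (η u σ : List Bool) : List Bool :=
  open Classical in if η <+: σ then u ++ σ.drop η.length else σ

theorem moveCone_of_prefix {η u σ : List Bool} (h : η <+: σ) :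
    moveCone η u σ = u ++ σ.drop η.length := if_pos h

theorem moveCone_of_not {η u σ : List Bool} (h : ¬ η <+: σ) : moveCone η u σ = σ := if_neg h

theorem moveCone_append (η u ρ : List Bool) : moveCone η u (η ++ ρ) = u ++ ρ := by
  rw [moveCone_of_prefix (List.prefix_append _ _), List.drop_left]

theorem comparable_of_prefix {σ τ ρ : List Bool} (h : σ <+: ρ) (h' : τ <+: ρ) :
    σ <+: τ ∨ τ <+: σ := List.prefix_or_prefix_of_prefix h h'

theorem moveCone_prefix_iff {η u : List Bool} (hu : η <+: u) (σ τ : List Bool) :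
    moveCone η u σ <+: moveCone η u τ ↔ σ <+: τ := by
  by_cases hσ : η <+: σ
  · obtain ⟨ρ, rfl⟩ := hσ
    rw [moveCone_append]
    by_cases hτ : η <+: τ
    · obtain ⟨ρ', rfl⟩ := hτ
      rw [moveCone_append, List.prefix_append_right_inj, List.prefix_append_right_inj]
    · rw [moveCone_of_not hτ]
      refine iff_of_false (fun h => hτ (hu.trans ((List.prefix_append _ _).trans h)))
        (fun h => hτ ((List.prefix_append _ _).trans h))
  · rw [moveCone_of_not hσ]
    by_cases hτ : η <+: τ
    · obtain ⟨ρ', rfl⟩ := hτ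
      rw [moveCone_append]
      constructor
      · intro h
        rcases comparable_of_prefix h (hu.trans (List.prefix_append u ρ')) with h | h
        · exact h.trans (List.prefix_append _ _)
        · exact absurd h hσ
      · intro h
        rcases comparable_of_prefix h (List.prefix_append η ρ') with h | h
        · exact h.trans (hu.trans (List.prefix_append _ _))
        · exact absurd h hσ
    · rw [moveCone_of_not hτ]

theorem prefix_antisymm {σ τ : List Bool} (h : σ <+: τ) (h' : τ <+: σ) : σ = τ :=
  h.eq_of_length (le_antisymm h.length_le h'.length_le)

/-- The nodes of the tree in which `η` is replaced by the two nodes `u` and `u'`. -/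
def fatten (η u u' : List Bool) (p : List Bool × Bool) : List Bool × Bool :=
  open Classical in if p.1 = η then (if p.2 then u' else u, false) else (moveCone η u' p.1, p.2)

section

variable {η u u' : List Bool}

theorem fatten_of_ne {p : List Bool × Bool} (h : p.1 ≠ η) :
    fatten η u u' p = (moveCone η u' p.1, p.2) := if_neg h

theorem fatten_of_eq {p : List Bool × Bool} (h : p.1 = η) :
    fatten η u u' p = (if p.2 then u' else u, false) := if_pos h

theorem prefix_fatten (hu' : u <+: u') {p : List Bool × Bool} (h : η <+: p.1) :
    u <+: (fatten η u u' p).1 := by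
  by_cases hp : p.1 = η
  · rw [fatten_of_eq hp]
    by_cases h2 : p.2 = true
    · simpa [h2] using hu'
    · simp [h2]
  · rw [fatten_of_ne hp]
    obtain ⟨ρ, hρ⟩ := h
    simp only
    rw [← hρ, moveCone_append]
    exact hu'.trans (List.prefix_append _ _)

/-- Only comparability survives, not its direction: the two copies at `η` have equal nodes, but
their images are `u` and `u'`. -/
theorem fatten_comparable (hu : η <+: u) (hu' : u <+: u') {p q : List Bool × Bool}
    (h : p.1 <+: q.1) : (fatten η u u' p).1 <+: (fatten η u u' q).1 ∨
      (fatten η u u' q).1 <+: (fatten η u u' p).1 := by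
  by_cases hp : p.1 = η
  · by_cases hq : q.1 = η
    · rw [fatten_of_eq hp, fatten_of_eq hq]
      rcases p with ⟨_, _ | _⟩ <;> rcases q with ⟨_, _ | _⟩ <;> simp [hu']
    · obtain ⟨ρ, hρ⟩ := h
      rw [hp] at hρ
      rw [fatten_of_eq hp, fatten_of_ne hq]
      left
      simp only
      rw [← hρ, moveCone_append]
      by_cases h2 : p.2 = true
      · simp [h2]
      · simpa [h2] using hu'.trans (List.prefix_append _ _)
  · by_cases hq : q.1 = η
    · have h1 : p.1 <+: u := (hq ▸ h).trans hu
      have h2 : ¬ η <+: p.1 := fun h' => hp (prefix_antisymm (hq ▸ h) h')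
      rw [fatten_of_ne hp, moveCone_of_not h2]
      exact Or.inl (h1.trans (prefix_fatten hu' (hq ▸ List.prefix_refl _)))
    · rw [fatten_of_ne hp, fatten_of_ne hq]
      exact Or.inl ((moveCone_prefix_iff (hu.trans hu') _ _).2 h)

/-- The copies of `η` go to nodes between `u` and `u'`. Other nodes of the cone go strictly above
`u'`, and nodes outside the cone do not extend `η`, hence not `u`. -/
theorem fatten_ne (hu : η <+: u) (hu' : u <+: u') {p q : List Bool × Bool} (hp : p.1 = η)
    (hq : q.1 ≠ η) : fatten η u u' p ≠ fatten η u u' q := by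
  intro h
  have h1 : (fatten η u u' p).1 <+: u' := by
    rw [fatten_of_eq hp]
    by_cases h2 : p.2 = true
    · simp [h2]
    · simpa [h2] using hu'
  have h2 := prefix_fatten (η := η) (u := u) hu' (p := p) (hp ▸ List.prefix_refl _)
  rw [h, fatten_of_ne hq] at h1 h2
  simp only at h1 h2
  by_cases h3 : η <+: q.1
  · obtain ⟨ρ, hρ⟩ := h3
    rw [← hρ, moveCone_append] at h1
    have := h1.length_le
    rw [List.length_append] at this
    have h4 : ρ = [] := List.eq_nil_of_length_eq_zero (by omega)
    rw [h4, List.append_nil] at hρ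
    exact hq hρ.symm
  · rw [moveCone_of_not h3] at h2
    exact h3 (hu.trans h2)

theorem fatten_injective (hu : η <+: u) (hu' : u <+: u') (hne : u ≠ u') :
    Function.Injective (fatten η u u') := by
  intro p q h
  by_cases hp : p.1 = η
  · by_cases hq : q.1 = η
    · rw [fatten_of_eq hp, fatten_of_eq hq] at h
      rcases p with ⟨_, _ | _⟩ <;> rcases q with ⟨_, _ | _⟩ <;> simp_all
    · exact absurd h (fatten_ne hu hu' hp hq)
  · by_cases hq : q.1 = η
    · exact absurd h.symm (fatten_ne hu hu' hq hp)
    · rw [fatten_of_ne hp, fatten_of_ne hq, Prod.mk.injEq] at h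
      refine Prod.ext (prefix_antisymm ?_ ?_) h.2
      · exact (moveCone_prefix_iff (hu.trans hu') _ _).1 (h.1 ▸ List.prefix_refl _)
      · exact (moveCone_prefix_iff (hu.trans hu') _ _).1 (h.1 ▸ List.prefix_refl _)

/-- No node of `F` lies in the cone of `η`, so doubled nodes are not moved; both copies of `η` are
sent to first parameters, which are always active. -/
theorem fatten_active {F : Set (List Bool)} (hF : ∀ σ ∈ F, ¬ η <+: σ) {p : List Bool × Bool}
    (hp : Active (insert η F) p) : Active F (fatten η u u' p) := by
  by_cases h : p.1 = η
  · rw [fatten_of_eq h]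
    exact fun h => absurd h (by simp)
  · rw [fatten_of_ne h]
    intro h2
    have h3 : p.1 ∈ F := (hp h2).resolve_left h
    simp only
    rwa [moveCone_of_not (hF _ h3)]

end

/-- Monochromatic inconsistency of pairs with a fixed finite set yields ATP. -/
theorem hasATP_of_inconsistent_pairs {n : ℕ} {ι : Type} [Finite ι] {φ : L.Formula (Fin n ⊕ ι)}
    {F : Set (List Bool)} {K : FirstOrder.Language.Theory.ModelType.{u, v, w} T}
    {b : List Bool × Bool → ι → K}
    (hb : ∀ P, (∀ p ∈ P, Active F p) → Spread P → Con φ b P) {η : List Bool}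
    {P : Finset (List Bool × Bool)} (hP : ∀ p ∈ P, Active F p) (hPs : Spread P)
    (hPη : ∀ p ∈ P, ¬ η <+: p.1 ∧ ¬ p.1 <+: η) {g : List Bool → List Bool} (hg : IsTreeEmb g)
    (hcon : ∀ σ τ, σ <+: τ → σ ≠ τ →
      ¬ Con φ b (insert (η ++ g σ, false) (insert (η ++ g τ, false) P))) :
    HasATP.{u, v, w} T := by
  classical
  -- The instances of `φ` at `P` become a constant part of the formula. Members of `P` are
  -- incomparable with `η`, so adding `P` to an antichain above `η` keeps it spread.
  let φ' : L.Formula (Fin n ⊕ (ι ⊕ (P × ι))) :=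
    φ.relabel (Sum.map id Sum.inl) ⊓ FirstOrder.Language.Formula.iInf fun p : P =>
      φ.relabel (Sum.elim Sum.inl fun j => Sum.inr (Sum.inr (p, j)))
  let b' : List Bool → ι ⊕ (P × ι) → K := fun σ =>
    Sum.elim (b (η ++ g σ, false)) fun pj => b pj.1 pj.2
  have real : ∀ σ x, φ'.Realize (Sum.elim x (b' σ)) ↔
      φ.Realize (Sum.elim x (b (η ++ g σ, false))) ∧ ∀ p ∈ P, φ.Realize (Sum.elim x (b p)) := by
    intro σ x
    simp only [φ', FirstOrder.Language.Formula.realize_inf,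
      FirstOrder.Language.Formula.realize_iInf, FirstOrder.Language.Formula.realize_relabel,
      Subtype.forall]
    have h1 : Sum.elim x (b' σ) ∘ Sum.map id Sum.inl = Sum.elim x (b (η ++ g σ, false)) := by
      funext i
      rcases i with i | i <;> rfl
    have h2 : ∀ p (hp : p ∈ P), Sum.elim x (b' σ) ∘
        (Sum.elim Sum.inl fun j => Sum.inr (Sum.inr (⟨p, hp⟩, j))) = Sum.elim x (b p) := by
      intro p hp
      funext i
      rcases i with i | i <;> rfl
    rw [h1]
    refine and_congr_right fun _ => forall₂_congr fun p hp => ?_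
    rw [h2 p hp]
  refine hasATP_of_finite φ' b' (fun X hX => ?_) fun σ τ hst hne hc => ?_
  · suffices hX' : Con φ b (X.image (fun σ => (η ++ g σ, false)) ∪ P) by
      obtain ⟨x, hx⟩ := hX'
      exact ⟨x, fun σ hσ => (real σ x).2
        ⟨hx _ (Finset.mem_union_left _ (Finset.mem_image_of_mem _ hσ)),
          fun p hp => hx _ (Finset.mem_union_right _ hp)⟩⟩
    refine hb _ ?_ ?_
    · intro p hp
      rcases Finset.mem_union.1 hp with hp | hp
      · obtain ⟨σ, _, rfl⟩ := Finset.mem_image.1 hp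
        exact fun h => absurd h (by simp)
      · exact hP p hp
    · intro p hp q hq hpq
      rcases Finset.mem_union.1 hp with hp | hp <;> rcases Finset.mem_union.1 hq with hq | hq
      · obtain ⟨σ, hσ, rfl⟩ := Finset.mem_image.1 hp
        obtain ⟨τ, hτ, rfl⟩ := Finset.mem_image.1 hq
        have h1 : σ <+: τ := (hg _ _).1 ((List.prefix_append_right_inj _).1 hpq)
        by_cases h2 : σ = τ
        · rw [h2]
        · exact absurd h1 (hX hσ hτ h2)
      · obtain ⟨σ, hσ, rfl⟩ := Finset.mem_image.1 hp
        exact absurd ((List.prefix_append _ _).trans hpq) (hPη q hq).1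
      · obtain ⟨σ, hσ, rfl⟩ := Finset.mem_image.1 hq
        rcases comparable_of_prefix hpq (List.prefix_append η (g σ)) with h | h
        · exact absurd h (hPη p hp).2
        · exact absurd h (hPη p hp).1
      · exact hPs p hp q hq hpq
  · obtain ⟨x, hx⟩ := hc
    refine hcon σ τ hst hne ⟨x, fun p hp => ?_⟩
    have h1 := (real σ x).1 (hx σ (by simp))
    have h2 := (real τ x).1 (hx τ (by simp))
    rcases Finset.mem_insert.1 hp with rfl | hp
    · exact h1.1
    rcases Finset.mem_insert.1 hp with rfl | hp
    · exact h2.1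
    · exact h1.2 p hp

/-- By compactness only a finite set `J` matters. Two nodes `u` and `u'` above `η` can serve as the
two parameters of `η`, with the rest of the cone moved above `u'`, as soon as they are jointly
consistent with every spread set of nodes incomparable with `η`. If no pair qualifies, each
comparable pair above `η` has a bad set among finitely many; a subtree on which this set is constant
gives ATP. -/
theorem FatPattern.insert (hT : ¬ HasATP.{u, v, max u v w} T) {n : ℕ} {ι : Type} [Finite ι]
    {φ : L.Formula (Fin n ⊕ ι)} {F : Set (List Bool)} {k : ℕ}
    (h : FatPattern.{u, v, max u v w} T φ F k) {η : List Bool} (hF : ∀ σ ∈ F, ¬ η <+: σ) :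
    FatPattern.{u, v, max u v w} T φ (insert η F) k := by
  classical
  obtain ⟨K, b, hb, hbk⟩ := h
  have := exists_pattern_of_finite.{u, v, w} (T := T) φ
    {P | (∀ p ∈ P, Active (Insert.insert η F) p) ∧ Spread P}
    {P | (∀ p ∈ P, Active (Insert.insert η F) p) ∧ Linear P ∧ k ≤ P.card} ?_
  · obtain ⟨K, b, h1, h2⟩ := this
    exact ⟨K, b, fun P hP hs => h1 P ⟨hP, hs⟩, fun P hP hl hk => h2 P ⟨hP, hl, hk⟩⟩
  intro J
  let R := J.filter fun p => ¬ η <+: p.1 ∧ ¬ p.1 <+: η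
  by_cases hgood : ∃ u u', η <+: u ∧ u <+: u' ∧ u ≠ u' ∧ ∀ P ⊆ R, (∀ p ∈ P, Active F p) →
      Spread P → Con φ b (Insert.insert (u, false) (Insert.insert (u', false) P))
  · obtain ⟨u, u', hu, hu', hne, hgood⟩ := hgood
    refine ⟨K, fun p => b (fatten η u u' p), ?_, ?_⟩
    · rintro P ⟨hP, hs⟩ hPJ
      rw [← con_image]
      by_cases hη : ∃ p ∈ P, p.1 = η
      · obtain ⟨p₀, hp₀, hpη⟩ := hη
        -- Since `P` is spread and contains `η`, its other nodes are incomparable with `η`: they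
        -- belong to `R` and are not moved.
        have hinc : ∀ p ∈ P, p.1 ≠ η → ¬ η <+: p.1 ∧ ¬ p.1 <+: η := by
          intro p hp hne
          constructor
          · intro h
            exact hne ((hs p₀ hp₀ p hp (hpη ▸ h)).symm.trans hpη)
          · intro h
            exact hne ((hs p hp p₀ hp₀ (hpη ▸ h)).trans hpη)
        refine (hgood (P.filter fun p => p.1 ≠ η) ?_ ?_ ?_).mono ?_
        · intro p hp
          obtain ⟨hp, hne⟩ := Finset.mem_filter.1 hp
          exact Finset.mem_filter.2 ⟨hPJ hp, hinc p hp hne⟩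
        · intro p hp h2
          obtain ⟨hp, hne⟩ := Finset.mem_filter.1 hp
          exact (hP p hp h2).resolve_left hne
        · intro p hp q hq
          exact hs p (Finset.mem_filter.1 hp).1 q (Finset.mem_filter.1 hq).1
        · intro q hq
          obtain ⟨p, hp, rfl⟩ := Finset.mem_image.1 hq
          by_cases h : p.1 = η
          · rw [fatten_of_eq h]
            by_cases h2 : p.2 = true <;> simp [h2]
          · rw [fatten_of_ne h, moveCone_of_not (hinc p hp h).1]
            simp [hp, h]
      · push Not at hη
        refine hb _ ?_ ?_
        · intro q hq
          obtain ⟨p, hp, rfl⟩ := Finset.mem_image.1 hq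
          exact fatten_active hF (hP p hp)
        · intro p' hp' q' hq'
          obtain ⟨p, hp, rfl⟩ := Finset.mem_image.1 hp'
          obtain ⟨q, hq, rfl⟩ := Finset.mem_image.1 hq'
          rw [fatten_of_ne (hη p hp), fatten_of_ne (hη q hq)]
          intro h
          have := hs p hp q hq ((moveCone_prefix_iff (hu.trans hu') _ _).1 h)
          simp only
          rw [this]
    · rintro P ⟨hP, hl, hk⟩ _
      rw [← con_image]
      refine hbk _ ?_ ?_ ?_
      · intro q hq
        obtain ⟨p, hp, rfl⟩ := Finset.mem_image.1 hq
        exact fatten_active hF (hP p hp)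
      · intro p' hp' q' hq'
        obtain ⟨p, hp, rfl⟩ := Finset.mem_image.1 hp'
        obtain ⟨q, hq, rfl⟩ := Finset.mem_image.1 hq'
        rcases hl p hp q hq with h | h
        · exact fatten_comparable hu hu' h
        · exact (fatten_comparable hu hu' h).symm
      · rwa [Finset.card_image_of_injective _ (fatten_injective hu hu' hne)]
  · exfalso
    push Not at hgood
    -- The coloring of pairs by a bad subset of `R`; pairs that are not strictly ordered receive the
    -- default value `∅`.
    have hbad : ∀ ρ ρ' : List Bool, ∃ P : R.powerset, ρ <+: ρ' → ρ ≠ ρ' →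
        (∀ p ∈ P.1, Active F p) ∧ Spread P.1 ∧
          ¬ Con φ b (Insert.insert (η ++ ρ, false) (Insert.insert (η ++ ρ', false) P.1)) := by
      intro ρ ρ'
      by_cases h : ρ <+: ρ' ∧ ρ ≠ ρ'
      · obtain ⟨P, hPR, hP⟩ := hgood (η ++ ρ) (η ++ ρ') (List.prefix_append _ _)
          ((List.prefix_append_right_inj _).2 h.1) (by simpa using h.2)
        exact ⟨⟨P, Finset.mem_powerset.2 hPR⟩, fun _ _ => hP⟩
      · exact ⟨⟨∅, by simp⟩, fun h1 h2 => absurd ⟨h1, h2⟩ h⟩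
    choose f hf using hbad
    obtain ⟨P, g, hg, hP⟩ := exists_pair_homogeneous f
    have key : ∀ σ τ, σ <+: τ → σ ≠ τ → (∀ p ∈ P.1, Active F p) ∧ Spread P.1 ∧
        ¬ Con φ b (Insert.insert (η ++ g σ, false) (Insert.insert (η ++ g τ, false) P.1)) := by
      intro σ τ h h'
      have := hf (g σ) (g τ) ((hg _ _).2 h) fun heq =>
        h' (prefix_antisymm h ((hg _ _).1 (heq ▸ List.prefix_refl _)))
      rwa [hP σ τ h h'] at this
    have h0 := key [] [true] (by simp) (by simp)
    refine hT (hasATP_of_inconsistent_pairs hb h0.1 h0.2.1 (fun p hp => ?_) hg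
      fun σ τ h h' => (key σ τ h h').2.2)
    exact (Finset.mem_filter.1 (Finset.mem_powerset.1 P.2 hp)).2

/-- Nodes are doubled from the root upwards and, within a level, one at a time. Then no node doubled
earlier extends the next one, as `FatPattern.insert` requires. -/
theorem FatPattern.levels (hT : ¬ HasATP.{u, v, max u v w} T) {n : ℕ} {ι : Type} [Finite ι]
    {φ : L.Formula (Fin n ⊕ ι)} {k : ℕ} (h : FatPattern.{u, v, max u v w} T φ ∅ k) (l : ℕ) :
    FatPattern.{u, v, max u v w} T φ {σ | σ.length < l} k := by
  classical
  induction l with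
  | zero => simpa using h
  | succ l ih =>
    have key : ∀ S : Finset (List Bool), (∀ σ ∈ S, σ.length = l) →
        FatPattern.{u, v, max u v w} T φ ({σ | σ.length < l} ∪ S) k := by
      intro S
      induction S using Finset.induction_on with
      | empty => intro _; simpa using ih
      | insert η S hη ihS =>
        intro hS
        have := (ihS fun σ hσ => hS σ (Finset.mem_insert_of_mem hσ)).insert hT (η := η) ?_
        · rwa [Finset.coe_insert, Set.union_insert]
        · have hl := hS η (Finset.mem_insert_self _ _)
          rintro σ (hσ | hσ) hpre
          · exact absurd hpre.length_le (not_le.2 (hl ▸ hσ))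
          · have := hS σ (Finset.mem_insert_of_mem hσ)
            rw [← hpre.eq_of_length (hl.trans this.symm)] at hσ
            exact hη hσ
    have := key (List.finite_length_eq Bool l).toFinset (by simp)
    convert this using 1
    ext σ
    simp only [Set.mem_ofPred_eq, Set.Finite.coe_toFinset, Set.mem_union]
    omega

/-- The formula `φ(x, y) ∧ φ(x, y')`. -/
def double {n : ℕ} {ι : Type} (φ : L.Formula (Fin n ⊕ ι)) : L.Formula (Fin n ⊕ (ι ⊕ ι)) :=
  φ.relabel (Sum.map id Sum.inl) ⊓ φ.relabel (Sum.map id Sum.inr)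

theorem realize_double {K : Type*} [L.Structure K] {n : ℕ} {ι : Type} {φ : L.Formula (Fin n ⊕ ι)}
    {x : Fin n → K} {y y' : ι → K} : (double φ).Realize (Sum.elim x (Sum.elim y y')) ↔
      φ.Realize (Sum.elim x y) ∧ φ.Realize (Sum.elim x y') := by
  have h1 : Sum.elim x (Sum.elim y y') ∘ Sum.map id Sum.inl = Sum.elim x y := by
    funext i
    rcases i with i | i <;> rfl
  have h2 : Sum.elim x (Sum.elim y y') ∘ Sum.map id Sum.inr = Sum.elim x y' := by
    funext i
    rcases i with i | i <;> rfl
  rw [double, FirstOrder.Language.Formula.realize_inf, FirstOrder.Language.Formula.realize_relabel,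
    FirstOrder.Language.Formula.realize_relabel, h1, h2]

/-- With two parameters at each relevant node, a chain of `k` nodes carries `2 * k` parameters,
while an antichain of doubled nodes is still a spread set. Finitely many levels suffice by
compactness. -/
theorem TreePattern.double (hT : ¬ HasATP.{u, v, max u v w} T) {n : ℕ} {ι : Type} [Finite ι]
    {φ : L.Formula (Fin n ⊕ ι)} {k : ℕ} (h : TreePattern.{u, v, max u v w} T φ (2 * k)) :
    TreePattern.{u, v, max u v w} T (double φ) k := by
  classical
  have := exists_pattern_of_finite.{u, v, w} (T := T) (LocalCharacter.double φ)
    {P : Finset (List Bool) | IsAntichain (fun σ τ => σ <+: τ) (P : Set (List Bool))}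
    {P | (∀ σ ∈ P, ∀ τ ∈ P, σ <+: τ ∨ τ <+: σ) ∧ k ≤ P.card} ?_
  · obtain ⟨K, b, h1, h2⟩ := this
    exact ⟨K, b, h1, fun P hl hk => h2 P ⟨hl, hk⟩⟩
  intro J
  obtain ⟨K, b, h1, h2⟩ := h.fatPattern.levels hT (J.sup List.length + 1)
  have hJ : ∀ P ⊆ J, ∀ p ∈ P ×ˢ (Finset.univ : Finset Bool),
      Active {σ | σ.length < J.sup List.length + 1} p := fun P hP p hp _ =>
    Nat.lt_succ_of_le (Finset.le_sup (hP (Finset.mem_product.1 hp).1))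
  have key : ∀ P : Finset (List Bool), Con (LocalCharacter.double φ)
      (fun σ => Sum.elim (b (σ, false)) (b (σ, true))) P ↔ Con φ b (P ×ˢ Finset.univ) := by
    intro P
    refine exists_congr fun x => ?_
    simp only [realize_double, Finset.mem_product, Finset.mem_univ, and_true, Prod.forall,
      Bool.forall_bool]
    exact ⟨fun h σ => ⟨fun hσ => (h σ hσ).1, fun hσ => (h σ hσ).2⟩,
      fun h σ hσ => ⟨(h σ).1 hσ, (h σ).2 hσ⟩⟩
  refine ⟨K, fun σ => Sum.elim (b (σ, false)) (b (σ, true)), fun P hP hPJ => ?_, ?_⟩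
  · refine (key P).2 (h1 _ (hJ P hPJ) fun p hp q hq hpq => ?_)
    by_contra hne
    exact hP (Finset.mem_product.1 hp).1 (Finset.mem_product.1 hq).1 hne hpq
  · rintro P ⟨hl, hk⟩ hPJ
    refine mt (key P).1 (h2 _ (hJ P hPJ) ?_ ?_)
    · exact fun p hp q hq => hl _ (Finset.mem_product.1 hp).1 _ (Finset.mem_product.1 hq).1
    · rw [Finset.card_product, Finset.card_univ, Fintype.card_bool]
      omega

/-- A tree with inconsistent long chains and consistent antichains yields ATP. -/
theorem TreePattern.hasATP {n : ℕ} {ι : Type} [Finite ι] {φ : L.Formula (Fin n ⊕ ι)} {k : ℕ}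
    (h : TreePattern.{u, v, max u v w} T φ k) : HasATP.{u, v, max u v w} T := by
  by_contra hT
  -- Halving ends at `2 ^ 0`, where the single instance at the root is inconsistent as a chain and
  -- consistent as an antichain.
  have key : ∀ (i : ℕ) (ι : Type) [Finite ι] (φ : L.Formula (Fin n ⊕ ι)),
      ¬ TreePattern.{u, v, max u v w} T φ (2 ^ i) := by
    intro i
    induction i with
    | zero =>
      rintro ι _ φ ⟨K, b, h1, h2⟩
      exact h2 {[]} (by simp) (by simp) (h1 {[]} (by simp))
    | succ i ih =>
      intro ι _ φ h
      rw [pow_succ'] at h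
      exact ih _ _ (h.double hT)
  obtain ⟨K, b, h1, h2⟩ := h
  exact key k ι φ ⟨K, b, h1, fun P hl hk => h2 P hl (k.lt_two_pow_self.le.trans hk)⟩

end Fattening

/-! ### Trees mixing Morley sequences of two types, and ATP -/

section MorleyTrees

variable {L : FirstOrder.Language.{u, v}} {𝕆 : Type w} [L.Structure 𝕆] {N : Set 𝕆} {m : ℕ}
  {U V : Ultrafilter (Fin m → 𝕆)}

theorem union_range_elim0 (A : Set 𝕆) : A ∪ Set.range (Fin.elim0 : Fin 0 → 𝕆) = A := by simp

theorem MorleyUF.sameType_initial {A : Set 𝕆} (hU : InvariantUF L U A) {r : ℕ}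
    {e e' : ℕ → Fin m → 𝕆} (he : MorleyUF L U A r e) (he' : MorleyUF L U A r e') :
    SameType L A (initial r e) (initial r e') := by
  rw [← union_range_elim0 A] at he he'
  simpa using (MorleyUF.sameType hU (SameType.refl _) he he').comp Sum.inl

theorem MorleyUF.of_sameType_initial {A : Set 𝕆} (hU : InvariantUF L U A) {r : ℕ}
    {e e' : ℕ → Fin m → 𝕆} (he : MorleyUF L U A r e)
    (h : SameType L A (initial r e) (initial r e')) : MorleyUF L U A r e' := by
  rw [← union_range_elim0 A] at he ⊢
  refine MorleyUF.of_sameType hU he ?_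
  have key : ∀ f : ℕ → Fin m → 𝕆, Sum.elim (initial r f) (Fin.elim0 : Fin 0 → 𝕆) =
      initial r f ∘ Sum.elim id fun i : Fin 0 => i.elim0 := by
    intro f
    funext i
    rcases i with i | i
    · rfl
    · exact i.elim0
  rw [key, key]
  exact h.comp _

theorem MorleyUF.append {A : Set 𝕆} {r s : ℕ} {e e' : ℕ → Fin m → 𝕆} (he : MorleyUF L U A r e)
    (he' : MorleyUF L U (A ∪ entries r e) s e') :
    MorleyUF L U A (r + s) fun i => if i < r then e i else e' (i - r) := by
  intro i hi
  by_cases h : i < r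
  · simp only [h, if_true]
    refine (he i h).mono (Set.union_subset_union_right _ ?_)
    intro x hx
    obtain ⟨j, hj, l, hx⟩ := mem_entries.1 hx
    rw [if_pos (hj.trans h)] at hx
    exact mem_entries.2 ⟨j, hj, l, hx⟩
  · simp only [h, if_false]
    refine (he' (i - r) (by omega)).mono ?_
    rw [Set.union_assoc]
    refine Set.union_subset_union_right _ ?_
    intro x hx
    obtain ⟨j, hj, l, hx⟩ := mem_entries.1 hx
    by_cases h' : j < r
    · rw [if_pos h'] at hx
      exact Or.inl (mem_entries.2 ⟨j, h', l, hx⟩)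
    · rw [if_neg h'] at hx
      exact Or.inr (mem_entries.2 ⟨j - r, by omega, l, hx⟩)

section Saturation

variable [Nonempty 𝕆]

theorem exists_realizesUF_union (hsat : IsSaturated L (Order.succ (Cardinal.mk N)) 𝕆)
    (hN : N.Infinite) {F : Set 𝕆} (hF : F.Finite) {k : ℕ} (W : Ultrafilter (Fin k → 𝕆)) :
    ∃ a, RealizesUF L W (N ∪ F) a := by
  refine hsat.exists_realizesUF W (Order.lt_succ_iff.2 ((Cardinal.mk_union_le _ _).trans ?_))
  have h1 : Cardinal.aleph0 ≤ Cardinal.mk N := Cardinal.infinite_iff.1 hN.to_subtype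
  have h2 : Cardinal.mk F ≤ Cardinal.mk N := (Cardinal.lt_aleph0_iff_set_finite.2 hF).le.trans h1
  exact Cardinal.add_le_of_le h1 le_rfl h2

theorem exists_morleyUF (hsat : IsSaturated L (Order.succ (Cardinal.mk N)) 𝕆)
    (hN : N.Infinite) {F : Set 𝕆} (hF : F.Finite) (U : Ultrafilter (Fin m → 𝕆)) :
    ∃ e, ∀ r, MorleyUF L U (N ∪ F) r e := by
  classical
  have : ∀ G : Finset 𝕆, ∃ a, RealizesUF L U (N ∪ G) a := fun G =>
    exists_realizesUF_union hsat hN G.finite_toSet U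
  choose next hnext using this
  -- The finite sets `S k` accumulate `F` and all entries chosen before stage `k`.
  let S : ℕ → Finset 𝕆 := fun k =>
    k.rec hF.toFinset fun _ G => G ∪ Finset.univ.image (next G)
  have hS : ∀ k, (S (k + 1)) = S k ∪ Finset.univ.image (next (S k)) := fun _ => rfl
  have key : ∀ k, F ∪ entries k (fun i => next (S i)) ⊆ {x | x ∈ S k} := by
    intro k
    induction k with
    | zero =>
      rintro x (hx | hx)
      · simpa [S] using hx
      · obtain ⟨j, hj, _⟩ := mem_entries.1 hx
        exact absurd hj (Nat.not_lt_zero _)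
    | succ k ih =>
      rintro x (hx | hx)
      · exact Finset.mem_union_left _ (ih (Or.inl hx))
      · obtain ⟨j, hj, i, rfl⟩ := mem_entries.1 hx
        rcases Nat.lt_succ_iff_lt_or_eq.1 hj with hj | rfl
        · exact Finset.mem_union_left _ (ih (Or.inr (mem_entries.2 ⟨j, hj, i, rfl⟩)))
        · exact Finset.mem_union_right _ (Finset.mem_image_of_mem _ (Finset.mem_univ i))
  refine ⟨fun i => next (S i), fun r i _ => (hnext (S i)).mono ?_⟩
  rw [Set.union_assoc]
  exact Set.union_subset_union_right _ (key i)

/-- If `p` is strongly bi-invariant, then a tuple `D` can be moved so that given Morley sequences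
in `p` over `N` are Morley sequences over `ND`. -/
theorem IsStronglyBiInvariant.exists_sameType {p : GlobalType L 𝕆 m} (hp : IsStronglyBiInvariant p N)
    (hU : Represents U p) (hsat : IsSaturated L (Order.succ (Cardinal.mk N)) 𝕆)
    (hN : N.Infinite) {ι : Type*} [Finite ι] (D : ι → 𝕆) {B : Set 𝕆} (hB : B.Finite) (R : ℕ) :
    ∃ D' : ι → 𝕆, SameType L N D' D ∧ ∀ r ≤ R, ∀ c : ℕ → Fin m → 𝕆, entries r c ⊆ B →
      MorleyUF L U N r c → MorleyUF L U (N ∪ Set.range D') r c := by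
  obtain ⟨k, ⟨f⟩⟩ := Finite.exists_equiv_fin ι
  have hinv : InvariantUF L U N := hU.isInvariant_iff.1 hp.1
  -- Strong bi-invariance is applied to a Morley sequence `e` over `ND`: it gives an `N`-invariant
  -- `W` extending `tp(D/Ne)`, and `D'` is chosen to realize `W` over `N`, `e` and `B`. A Morley
  -- sequence `c` in `B` has the type over `N` of an initial part of `e`, so by invariance of `W`
  -- the pair `D', c` looks like `D, e`.
  obtain ⟨e, he⟩ := exists_morleyUF hsat hN (Set.finite_range D) U
  have hr : Set.range (D ∘ f.symm) = Set.range D := f.symm.surjective.range_comp D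
  have h1 := hp.2 R k (fun i => e i) (D ∘ f.symm)
    (by rw [hr]; exact hU.realizesPower_iff.2 (he R))
  have h2 : (⋃ i : Fin R, Set.range (e i)) = entries R e := by
    ext x
    simp only [mem_entries, Set.mem_iUnion, Set.mem_range]
    exact ⟨fun ⟨i, hi⟩ => ⟨i, i.2, hi⟩, fun ⟨i, hi, h⟩ => ⟨⟨i, hi⟩, h⟩⟩
  rw [h2] at h1
  obtain ⟨W, hW, hWD⟩ := invariantlyIndep_iff.1 h1
  obtain ⟨D', hD'⟩ := exists_realizesUF_union hsat hN ((finite_entries R e).union hB) W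
  have hcomp : ∀ (c : ℕ → Fin m → 𝕆) (r : ℕ) (E : Fin k → 𝕆),
      Sum.elim (initial r c) (E ∘ f) =
        Sum.elim E (initial r c) ∘ Sum.elim Sum.inr (Sum.inl ∘ f) := by
    intro c r E
    funext i
    rcases i with i | i <;> rfl
  have hD : (D ∘ f.symm) ∘ f = D := by
    funext i
    simp
  refine ⟨D' ∘ f, ?_, fun r hrR c hc hcM => ?_⟩
  · have := ((hD'.mono Set.subset_union_left).sameType (hWD.mono Set.subset_union_left)).comp f
    rwa [hD] at this
  · have h3 : MorleyUF L U N r e := (he r).mono Set.subset_union_left le_rfl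
    have h4 := hW.sameType_elim (c := initial r e) (c' := initial r c) (d := D ∘ f.symm) (d' := D')
      (hWD.mono ?_) (hD'.mono ?_) (h3.sameType_initial hinv hcM)
    · refine MorleyUF.of_sameType hinv (he r) ?_
      have := h4.comp (Sum.elim Sum.inr (Sum.inl ∘ f))
      rwa [← hcomp, ← hcomp, hD] at this
    · rw [range_initial]
      exact Set.union_subset_union_right _ (entries_mono hrR e)
    · rw [range_initial]
      exact Set.union_subset_union_right _ (hc.trans Set.subset_union_right)

end Saturation

/-- A binary tree of height `n` whose antichains are Morley sequences over `N` in the type defined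
by `U`, of length at most `R`, and whose paths, read downwards, are Morley sequences over `N` in the
type defined by `V`. -/
structure IsMorleyTree (L : FirstOrder.Language.{u, v}) {𝕆 : Type w} [L.Structure 𝕆] {m : ℕ}
    (U V : Ultrafilter (Fin m → 𝕆)) (N : Set 𝕆) (n R : ℕ) (b : List Bool → Fin m → 𝕆) : Prop where
  antichain : ∀ X : Finset (List Bool), (∀ σ ∈ X, σ.length < n) →
    IsAntichain (fun σ τ => σ <+: τ) (X : Set (List Bool)) → ∃ r ≤ R, ∃ s : ℕ → List Bool,
      (∀ σ ∈ X, ∃ i < r, s i = σ) ∧ (∀ i < r, s i ∈ X) ∧ MorleyUF L U N r fun i => b (s i)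
  path : ∀ σ : List Bool, σ.length < n →
    RealizesUF L V
      (N ∪ {x | ∃ τ : List Bool, σ <+: τ ∧ σ ≠ τ ∧ τ.length < n ∧ x ∈ Set.range (b τ)}) (b σ)

/-- Two trees joined by a root. -/
def joinTrees (a : Fin m → 𝕆) (b b' : List Bool → Fin m → 𝕆) : List Bool → Fin m → 𝕆
  | [] => a
  | false :: σ => b σ
  | true :: σ => b' σ

/-- The entries of a tree of height `n`, as one tuple. -/
def treeTuple (n : ℕ) (b : List Bool → Fin m → 𝕆) : {σ : List Bool // σ.length < n} × Fin m → 𝕆 :=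
  fun x => b x.1 x.2

instance finite_nodes (n : ℕ) : Finite {σ : List Bool // σ.length < n} :=
  (List.finite_length_lt Bool n).to_subtype

/-- Both conditions depend only on the type of the whole tree over `N`, because `U` and `V` are
`N`-invariant. -/
theorem IsMorleyTree.of_sameType (hU : InvariantUF L U N) (hV : InvariantUF L V N) {n R : ℕ}
    {b b' : List Bool → Fin m → 𝕆} (h : IsMorleyTree L U V N n R b)
    (hb : SameType L N (treeTuple n b) (treeTuple n b')) : IsMorleyTree L U V N n R b' where
  antichain X hX hXa := by
    obtain ⟨r, hr, s, h1, h2, h3⟩ := h.antichain X hX hXa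
    refine ⟨r, hr, s, h1, h2, h3.of_sameType_initial hU ?_⟩
    exact hb.comp fun ij : Fin r × Fin m => (⟨s ij.1, hX _ (h2 _ ij.1.2)⟩, ij.2)
  path σ hσ := by
    let I := {τ : {τ : List Bool // τ.length < n} // σ <+: τ.1 ∧ σ ≠ τ.1}
    have key : ∀ c : List Bool → Fin m → 𝕆,
        {x | ∃ τ : List Bool, σ <+: τ ∧ σ ≠ τ ∧ τ.length < n ∧ x ∈ Set.range (c τ)} =
          Set.range fun ij : I × Fin m => c ij.1.1.1 ij.2 := by
      intro c
      ext x
      constructor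
      · rintro ⟨τ, h1, h2, h3, j, rfl⟩
        exact ⟨(⟨⟨τ, h3⟩, h1, h2⟩, j), rfl⟩
      · rintro ⟨⟨⟨⟨τ, h3⟩, h1, h2⟩, j⟩, rfl⟩
        exact ⟨τ, h1, h2, h3, j, rfl⟩
    have h1 := h.path σ hσ
    rw [key] at h1 ⊢
    refine hV.realizesUF_congr h1 ?_
    have key2 : ∀ c : List Bool → Fin m → 𝕆,
        Sum.elim (c σ) (fun ij : I × Fin m => c ij.1.1.1 ij.2) =
          treeTuple n c ∘ Sum.elim (fun j => (⟨σ, hσ⟩, j)) fun ij => (ij.1.1, ij.2) := by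
      intro c
      funext i
      rcases i with i | i <;> rfl
    rw [key2, key2]
    exact hb.comp _

/-- A tree of height `n` is placed beside a copy of itself, moved so that the Morley sequences in
the original stay Morley over the copy. An antichain of the union is then a sequence from the copy
followed by one from the original. A new root realizing `V` over both trees prolongs every path
downwards. -/
theorem exists_isMorleyTree [Nonempty 𝕆] {p : GlobalType L 𝕆 m} (hp : IsStronglyBiInvariant p N)
    (hU : Represents U p) (hV : InvariantUF L V N)
    (hsat : IsSaturated L (Order.succ (Cardinal.mk N)) 𝕆) (hN : N.Infinite) {d : Fin m → 𝕆}
    (hdU : RealizesUF L U N d) (hdV : RealizesUF L V N d) (n : ℕ) :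
    ∃ R b, IsMorleyTree L U V N n R b := by
  classical
  have hinv : InvariantUF L U N := hU.isInvariant_iff.1 hp.1
  induction n with
  | zero =>
    refine ⟨0, fun _ => d, fun X hX _ => ⟨0, le_rfl, fun _ => [], fun σ hσ => ?_, ?_, ?_⟩,
      fun σ hσ => absurd hσ (Nat.not_lt_zero _)⟩
    · exact absurd (hX σ hσ) (Nat.not_lt_zero _)
    · exact fun i hi => absurd hi (Nat.not_lt_zero _)
    · exact fun i hi => absurd hi (Nat.not_lt_zero _)
  | succ n ih =>
    obtain ⟨R, b, hb⟩ := ih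
    obtain ⟨D, hD, hDM⟩ := hp.exists_sameType hU hsat hN (treeTuple n b)
      (Set.finite_range (treeTuple n b)) R
    let b₀ : List Bool → Fin m → 𝕆 := fun σ j =>
      if h : σ.length < n then D (⟨σ, h⟩, j) else d j
    have hb₀D : treeTuple n b₀ = D := by
      funext x
      simp [treeTuple, b₀, x.1.2]
    have hb₀ : IsMorleyTree L U V N n R b₀ := by
      refine hb.of_sameType hinv hV ?_
      rw [hb₀D]
      exact hD.symm
    rw [← hb₀D] at hDM
    obtain ⟨a, ha⟩ := exists_realizesUF_union hsat hN
      ((Set.finite_range (treeTuple n b₀)).union (Set.finite_range (treeTuple n b))) V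
    -- The root alone is an antichain, and here it matters that both types extend `tp(d/N)`.
    have haU : RealizesUF L U N a :=
      hdU.of_sameType (hdV.sameType (ha.mono Set.subset_union_left))
    refine ⟨R + R + 1, joinTrees a b₀ b, fun X hX hXa => ?_, fun σ hσ => ?_⟩
    · by_cases hnil : [] ∈ X
      · refine ⟨1, by omega, fun _ => [], fun σ hσ => ⟨0, Nat.one_pos, ?_⟩, fun _ _ => hnil, ?_⟩
        · by_contra hne
          exact hXa hnil hσ hne List.nil_prefix
        · intro i hi
          have h0 : i = 0 := by omega
          subst h0
          refine haU.mono (Set.union_subset subset_rfl fun x hx => ?_)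
          obtain ⟨j, hj, _⟩ := mem_entries.1 hx
          exact absurd hj (Nat.not_lt_zero _)
      · have side : ∀ i : Bool, ∀ c, IsMorleyTree L U V N n R c → ∃ r ≤ R, ∃ s : ℕ → List Bool,
            (∀ σ, i :: σ ∈ X → ∃ l < r, s l = σ) ∧
            (∀ l < r, i :: s l ∈ X) ∧ MorleyUF L U N r fun l => c (s l) := by
          intro i c hc
          have hlen : ∀ σ ∈ X.preimage (List.cons i) List.cons_injective.injOn, σ.length < n := by
            intro σ hσ
            have := hX _ (Finset.mem_preimage.1 hσ)
            rw [List.length_cons] at this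
            omega
          obtain ⟨r, hr, s, h1, h2, h3⟩ := hc.antichain _ hlen fun σ hσ τ hτ hne hpre =>
            hXa (Finset.mem_preimage.1 hσ) (Finset.mem_preimage.1 hτ) (by simpa using hne)
              (by simpa using hpre)
          exact ⟨r, hr, s, fun σ hσ => h1 σ (Finset.mem_preimage.2 hσ),
            fun l hl => Finset.mem_preimage.1 (h2 l hl), h3⟩
        obtain ⟨r₀, hr₀, s₀, h1, h2, h3⟩ := side false b₀ hb₀
        obtain ⟨r₁, hr₁, s₁, k1, k2, k3⟩ := side true b hb
        have len₀ : ∀ l < r₀, (s₀ l).length < n := fun l hl => by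
          have := hX _ (h2 l hl)
          rw [List.length_cons] at this
          omega
        have len₁ : ∀ l < r₁, (s₁ l).length < n := fun l hl => by
          have := hX _ (k2 l hl)
          rw [List.length_cons] at this
          omega
        refine ⟨r₀ + r₁, by omega,
          fun i => if i < r₀ then false :: s₀ i else true :: s₁ (i - r₀), ?_, ?_, ?_⟩
        · rintro (_ | ⟨_ | _, σ⟩) hσ
          · exact absurd hσ hnil
          · obtain ⟨l, hl, rfl⟩ := h1 σ hσ
            exact ⟨l, by omega, by simp [hl]⟩
          · obtain ⟨l, hl, rfl⟩ := k1 σ hσ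
            exact ⟨r₀ + l, by omega, by simp⟩
        · intro i hi
          by_cases h : i < r₀
          · simpa [h] using h2 i h
          · simpa [h] using k2 (i - r₀) (by omega)
        · have hsub : entries r₁ (fun l => b (s₁ l)) ⊆ Set.range (treeTuple n b) := by
            intro x hx
            obtain ⟨j, hj, i, hx⟩ := mem_entries.1 hx
            exact ⟨(⟨s₁ j, len₁ j hj⟩, i), hx⟩
          -- The part in the copy `b₀` comes first, since it is the part in `b` that is Morley over
          -- the other tree.
          have h4 := h3.append ((hDM r₁ hr₁ _ hsub k3).mono
            (Set.union_subset_union_right _ fun x hx => by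
              obtain ⟨j, hj, i, hx⟩ := mem_entries.1 hx
              exact ⟨(⟨s₀ j, len₀ j hj⟩, i), hx⟩) le_rfl)
          refine h4.congr fun i hi => ?_
          by_cases h : i < r₀ <;> simp [h, joinTrees]
    · rcases σ with _ | ⟨_ | _, σ⟩
      · refine ha.mono (Set.union_subset_union_right _ ?_)
        rintro x ⟨_ | ⟨_ | _, τ⟩, _, h2, h3, j, rfl⟩
        · exact absurd rfl h2
        · exact Or.inl ⟨(⟨τ, by simpa using h3⟩, j), rfl⟩
        · exact Or.inr ⟨(⟨τ, by simpa using h3⟩, j), rfl⟩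
      · refine (hb₀.path σ (by simpa using hσ)).mono (Set.union_subset_union_right _ ?_)
        rintro x ⟨_ | ⟨_ | _, τ⟩, h1, h2, h3, hx⟩
        · simp at h1
        · exact ⟨τ, by simpa using h1, by simpa using h2, by simpa using h3, hx⟩
        · simp at h1
      · refine (hb.path σ (by simpa using hσ)).mono (Set.union_subset_union_right _ ?_)
        rintro x ⟨_ | ⟨_ | _, τ⟩, h1, h2, h3, hx⟩
        · simp at h1
        · simp at h1
        · exact ⟨τ, by simpa using h1, by simpa using h2, by simpa using h3, hx⟩

theorem definable_con (A : Set 𝕆) {n : ℕ} {I ι : Type*} (φ : L.Formula (Fin n ⊕ ι))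
    (P : Finset I) : A.Definable L {v : I × ι → 𝕆 | Con φ (fun i j => v (i, j)) P} := by
  refine Set.Definable.mono (A := ∅) (Set.empty_definable_iff.2 ⟨conFormula φ P, ?_⟩)
    (Set.empty_subset _)
  ext v
  exact realize_conFormula.symm

theorem con_range_iff {n : ℕ} {φ : L.Formula (Fin n ⊕ Fin m)} {r : ℕ} {e : ℕ → Fin m → 𝕆} :
    Con φ e (Finset.range r) ↔ Con φ (fun i j => initial r e (i, j)) Finset.univ := by
  refine exists_congr fun x => ?_
  simp only [Finset.mem_range, Finset.mem_univ, true_imp_iff]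
  exact ⟨fun h i => h i i.2, fun h i hi => h ⟨i, hi⟩⟩

theorem con_range_congr {A : Set 𝕆} {n : ℕ} (φ : L.Formula (Fin n ⊕ Fin m)) {r : ℕ}
    {e e' : ℕ → Fin m → 𝕆} (h : SameType L A (initial r e) (initial r e')) :
    Con φ e (Finset.range r) ↔ Con φ e' (Finset.range r) := by
  rw [con_range_iff, con_range_iff]
  exact h _ (definable_con A φ Finset.univ)

theorem consistentOn_univ_iff {A : Set 𝕆} {n : ℕ} {φ : L.Formula (Fin n ⊕ Fin m)}
    {e : ℕ → Fin m → 𝕆} :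
    ConsistentOn ((L.lhomWithConstants A).onFormula φ) e Set.univ ↔
      ∀ r, Con φ e (Finset.range r) := by
  simp only [ConsistentOn, FirstOrder.Language.LHom.realize_onFormula]
  constructor
  · intro h r
    exact h _ (Set.subset_univ _)
  · intro h s _
    obtain ⟨r, hr⟩ := s.exists_nat_subset_range
    exact (h r).mono hr

theorem kimDividesAlong_iff {n : ℕ} {φ : L.Formula (Fin n ⊕ Fin m)} {q : GlobalType L 𝕆 m}
    (hV : Represents V q) :
    KimDividesAlong N ((L.lhomWithConstants N).onFormula φ) q ↔
      ∃ e, (∀ r, MorleyUF L V N r e) ∧ ∃ k, ¬ Con φ e (Finset.range k) := by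
  simp only [KimDividesAlong, hV.isMorleySequence_iff, consistentOn_univ_iff, not_forall]

/-- The longest node is listed first, because paths are Morley sequences from the top down. -/
theorem exists_chain_enumeration (k : ℕ) (P : Finset (List Bool))
    (hP : ∀ σ ∈ P, ∀ τ ∈ P, σ <+: τ ∨ τ <+: σ) (hk : k ≤ P.card) :
    ∃ s : ℕ → List Bool, (∀ i < k, s i ∈ P) ∧ ∀ j < k, ∀ i < j, s j <+: s i ∧ s j ≠ s i := by
  classical
  induction k generalizing P with
  | zero => exact ⟨fun _ => [], fun i hi => absurd hi (Nat.not_lt_zero _),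
      fun i hi => absurd hi (Nat.not_lt_zero _)⟩
  | succ k ih =>
    obtain ⟨σ, hσ, hmax⟩ := P.exists_max_image List.length (Finset.card_pos.1 (by omega))
    obtain ⟨s, h1, h2⟩ := ih (P.erase σ)
      (fun τ hτ ρ hρ => hP τ (Finset.mem_of_mem_erase hτ) ρ (Finset.mem_of_mem_erase hρ))
      (by rw [Finset.card_erase_of_mem hσ]; omega)
    refine ⟨fun i => i.casesOn σ s, ?_, ?_⟩
    · rintro (_ | i) hi
      · exact hσ
      · exact Finset.mem_of_mem_erase (h1 i (by omega))
    · rintro (_ | j) hj (_ | i) hi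
      · omega
      · omega
      · have hmem := h1 j (by omega)
        have hne := Finset.ne_of_mem_erase hmem
        refine ⟨?_, hne⟩
        rcases hP _ (Finset.mem_of_mem_erase hmem) σ hσ with h | h
        · exact h
        · exact absurd (h.eq_of_length
            (le_antisymm h.length_le (hmax _ (Finset.mem_of_mem_erase hmem)))).symm hne
      · exact h2 j (by omega) i (by omega)

end MorleyTrees

/-- In a Morley tree for `p` and `q`, antichains inherit consistency from Morley sequences in `p`,
and chains of size `k` inherit inconsistency from the dividing sequence in `q`. Compactness passes
from finite heights to the full tree, and `TreePattern.hasATP` concludes. -/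
theorem hasATP_of_strongBiInvariantKimFailure {L : FirstOrder.Language.{u, v}} {T : L.Theory}
    (hT : ∀ K : FirstOrder.Language.Theory.ModelType.{u, v, max u v w} T, Infinite K)
    (h : StrongBiInvariantKimFailure.{u, v, max u v w} T) : HasATP.{u, v, max u v w} T := by
  classical
  obtain ⟨𝕆, N, hsat, n, m, φ, d, p, q, hp, hpd, hq, hqd, hqφ, hpφ⟩ := h
  have hN : (N : Set 𝕆).Infinite :=
    Set.infinite_coe_iff.1 (hT (FirstOrder.Language.Theory.ModelType.of T N))
  obtain ⟨U, hU⟩ := p.exists_represents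
  obtain ⟨V, hV⟩ := q.exists_represents
  have hUi : InvariantUF L U (N : Set 𝕆) := hU.isInvariant_iff.1 hp.1
  have hVi : InvariantUF L V (N : Set 𝕆) := hV.isInvariant_iff.1 hq
  obtain ⟨e, he, k, hk⟩ := (kimDividesAlong_iff hV).1 hqφ
  have hcon : ∀ r c, MorleyUF L U (N : Set 𝕆) r c → Con φ c (Finset.range r) := by
    intro r c hc
    obtain ⟨e, he⟩ := exists_morleyUF hsat hN Set.finite_empty U
    rw [Set.union_empty] at he
    refine (con_range_congr φ ((he r).sameType_initial hUi hc)).1 ?_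
    by_contra hr
    exact hpφ ((kimDividesAlong_iff hU).2 ⟨e, he, r, hr⟩)
  refine TreePattern.hasATP (φ := φ) (k := k) ?_
  have := exists_pattern_of_finite.{u, v, w} (T := T) φ
    {P : Finset (List Bool) | IsAntichain (fun σ τ => σ <+: τ) (P : Set (List Bool))}
    {P | (∀ σ ∈ P, ∀ τ ∈ P, σ <+: τ ∨ τ <+: σ) ∧ k ≤ P.card} ?_
  · obtain ⟨K, b, h1, h2⟩ := this
    exact ⟨K, b, h1, fun P hl hk => h2 P ⟨hl, hk⟩⟩
  intro J
  obtain ⟨R, b, hb⟩ := exists_isMorleyTree hp hU hVi hsat hN (hU.realizesRestriction_iff.1 hpd)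
    (hV.realizesRestriction_iff.1 hqd) (J.sup List.length + 1)
  have hJ : ∀ P ⊆ J, ∀ σ ∈ P, σ.length < J.sup List.length + 1 := fun P hP σ hσ =>
    Nat.lt_succ_of_le (Finset.le_sup (hP hσ))
  refine ⟨𝕆, b, fun P hP hPJ => ?_, ?_⟩
  · obtain ⟨r, _, s, h1, h2, h3⟩ := hb.antichain P (hJ P hPJ) hP
    obtain ⟨x, hx⟩ := hcon r _ h3
    refine ⟨x, fun σ hσ => ?_⟩
    obtain ⟨i, hi, rfl⟩ := h1 σ hσ
    exact hx i (Finset.mem_range.2 hi)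
  · rintro P ⟨hl, hPk⟩ hPJ hc
    obtain ⟨s, h1, h2⟩ := exists_chain_enumeration k P hl hPk
    have hM : MorleyUF L V (N : Set 𝕆) k fun i => b (s i) := by
      intro i hi
      refine (hb.path (s i) (hJ P hPJ _ (h1 i hi))).mono (Set.union_subset_union_right _ ?_)
      intro x hx
      obtain ⟨j, hj, l, hx⟩ := mem_entries.1 hx
      exact ⟨s j, (h2 i hi j hj).1, (h2 i hi j hj).2, hJ P hPJ _ (h1 j (hj.trans hi)), l, hx⟩
    refine hk ((con_range_congr φ ((he k).sameType_initial hVi hM)).2 ?_)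
    obtain ⟨x, hx⟩ := hc
    exact ⟨x, fun i hi => hx _ (h1 i (Finset.mem_range.1 hi))⟩

/-! ### Saturation inside `O` and sets full over `M` -/

section FullSets

variable {L : FirstOrder.Language.{u, v}} {𝕆 : Type w} [L.Structure 𝕆]

theorem exists_fin_definable {A : Set 𝕆} {ι : Type*} {S : Set (ι → 𝕆)} (hS : A.Definable L S) :
    ∃ (k : ℕ) (c : Fin k → 𝕆), Set.range c ⊆ A ∧ (Set.range c).Definable L S := by
  obtain ⟨B, hB, hS⟩ := Set.definable_iff_finitely_definable.1 hS
  have hr : Set.range (fun i => (B.equivFin.symm i : 𝕆)) = B := by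
    ext x
    constructor
    · rintro ⟨i, rfl⟩
      exact (B.equivFin.symm i).2
    · intro hx
      exact ⟨B.equivFin ⟨x, hx⟩, by simp⟩
  exact ⟨B.card, fun i => B.equivFin.symm i, hr ▸ hB, hr ▸ hS⟩

/-- An ultrafilter on tuples from a set `N` with prescribed definable members. -/
theorem exists_ultrafilter_of_meets {C : Set 𝕆} {ι α : Type*} (f : α → ι → 𝕆) {b : ι → 𝕆}
    (h : ∀ S : Set (ι → 𝕆), C.Definable L S → b ∈ S → ∃ x, f x ∈ S) :
    ∃ U : Ultrafilter α, ∀ S : Set (ι → 𝕆), C.Definable L S → (f ⁻¹' S ∈ U ↔ b ∈ S) := by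
  let F : Filter α :=
    { sets := {W | ∃ S : Set (ι → 𝕆), C.Definable L S ∧ b ∈ S ∧ f ⁻¹' S ⊆ W}
      univ_sets := ⟨Set.univ, Set.definable_univ, Set.mem_univ _, Set.subset_univ _⟩
      sets_of_superset := fun ⟨S, h1, h2, h3⟩ hs => ⟨S, h1, h2, h3.trans hs⟩
      inter_sets := fun ⟨S, h1, h2, h3⟩ ⟨S', k1, k2, k3⟩ =>
        ⟨S ∩ S', h1.inter k1, ⟨h2, k2⟩, fun x hx => ⟨h3 hx.1, k3 hx.2⟩⟩ }
  have hF : F.NeBot := by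
    refine ⟨fun hb => ?_⟩
    have : (∅ : Set α) ∈ F := by rw [hb]; trivial
    obtain ⟨S, h1, h2, h3⟩ := this
    obtain ⟨x, hx⟩ := h S h1 h2
    exact h3 hx
  have key : ∀ S : Set (ι → 𝕆), C.Definable L S → b ∈ S → f ⁻¹' S ∈ Ultrafilter.of F :=
    fun S h1 h2 => Ultrafilter.of_le F ⟨S, h1, h2, subset_rfl⟩
  refine ⟨Ultrafilter.of F, fun S hS => ⟨fun hU => ?_, key S hS⟩⟩
  by_contra hn
  obtain ⟨x, hx, hx'⟩ := Ultrafilter.nonempty_of_mem (Filter.inter_mem hU (key Sᶜ hS.compl hn))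
  exact hx' hx

/-- A saturated elementary substructure realizes the types over its small subsets that are realized
in the ambient structure. -/
theorem exists_sameType_of_isSaturated [Nonempty 𝕆] {O : L.ElementarySubstructure 𝕆}
    {κ : Cardinal.{w}} (hO : IsSaturated L (Order.succ κ) O) {A : Set 𝕆} (hA : A ⊆ O)
    (hAκ : Cardinal.mk A ≤ κ) {l : ℕ} (b : Fin l → 𝕆) :
    ∃ b' : Fin l → 𝕆, (∀ i, b' i ∈ (O : Set 𝕆)) ∧ SameType L A b' b := by
  have formula : ∀ S : Set (Fin l → 𝕆), A.Definable L S → ∃ φ : L.Formula (A ⊕ Fin l),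
      S = {v | φ.Realize (Sum.elim (↑) v)} := fun S hS =>
    Set.definable_iff_exists_formula_sum.1 hS
  let a : A → O := fun x => ⟨x, hA x.2⟩
  have elem : ∀ (φ : L.Formula (A ⊕ Fin l)) (x : Fin l → O),
      φ.Realize (Sum.elim (fun c : A => (c : 𝕆)) fun i => (x i : 𝕆)) ↔
        φ.Realize (Sum.elim a x) := by
    intro φ x
    rw [← O.subtype.map_formula φ]
    have : (O.subtype ∘ Sum.elim a x : A ⊕ Fin l → 𝕆) =
        Sum.elim (fun c : A => (c : 𝕆)) fun i => (x i : 𝕆) := by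
      funext i
      rcases i with i | i <;> rfl
    rw [this]
  -- By elementarity, `tp(b/A)` is finitely satisfiable in `O`, so it is given by an ultrafilter on
  -- tuples from `O`, to which the saturation of `O` applies.
  obtain ⟨U, hU⟩ := exists_ultrafilter_of_meets (L := L) (C := A) (b := b)
    (fun (x : Fin l → O) i => (x i : 𝕆)) (by
      intro S hS hb
      obtain ⟨φ, rfl⟩ := formula S hS
      have h1 : (φ.iExs (Fin l)).Realize (O.subtype ∘ a) :=
        FirstOrder.Language.Formula.realize_iExs.2 ⟨b, hb⟩
      rw [O.subtype.map_formula, FirstOrder.Language.Formula.realize_iExs] at h1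
      obtain ⟨x, hx⟩ := h1
      exact ⟨x, (elem φ x).2 hx⟩)
  have hA' : Cardinal.mk {o : O | (o : 𝕆) ∈ A} < Order.succ κ := by
    refine Order.lt_succ_iff.2 (le_trans ?_ hAκ)
    exact Cardinal.mk_le_of_injective (f := fun o => (⟨o.1.1, o.2⟩ : A)) fun o o' h =>
      Subtype.ext (Subtype.ext (congrArg (fun z : A => (z : 𝕆)) h))
  obtain ⟨x, hx⟩ := hO.exists_realizesUF U hA'
  refine ⟨fun i => x i, fun i => (x i).2, fun S hS => ?_⟩
  rw [← hU S hS]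
  refine (hx ((fun (y : Fin l → O) i => (y i : 𝕆)) ⁻¹' S) ?_).symm
  obtain ⟨φ, rfl⟩ := formula S hS
  let g : A → {o : O | (o : 𝕆) ∈ A} := fun c => ⟨a c, c.2⟩
  refine Set.definable_iff_exists_formula_sum.2 ⟨φ.relabel (Sum.map g id), ?_⟩
  ext y
  change φ.Realize (Sum.elim (fun c : A => (c : 𝕆)) fun i => (y i : 𝕆)) ↔ (φ.relabel _).Realize _
  rw [elem, FirstOrder.Language.Formula.realize_relabel]
  have : (Sum.elim (fun o : {o : O | (o : 𝕆) ∈ A} => (o : O)) y ∘ Sum.map g id :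
      A ⊕ Fin l → O) = Sum.elim a y := by
    funext i
    rcases i with i | i <;> rfl
  rw [this]

/-- Otherwise a nonprincipal type over the whole structure would be realized by some `a` and contain
the formula `x = a`. -/
theorem IsSaturated.lt_mk [Nonempty 𝕆] [Infinite 𝕆] {κ : Cardinal.{w}}
    (h : IsSaturated L (Order.succ κ) 𝕆) : κ < Cardinal.mk 𝕆 := by
  by_contra hκ
  obtain ⟨a, ha⟩ := h.exists_realizesUF (A := Set.univ) (Filter.hyperfilter (Fin 1 → 𝕆))
    (by rw [Cardinal.mk_univ]; exact Order.lt_succ_iff.2 (not_lt.1 hκ))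
  have h1 : {x : Fin 1 → 𝕆 | x 0 ∈ ({a 0} : Set 𝕆)} ∈ Filter.hyperfilter (Fin 1 → 𝕆) :=
    (ha _ (Set.Definable.singleton_of_mem (L := L) (Set.mem_univ (a 0)))).2 rfl
  refine Set.Finite.notMem_hyperfilter ?_ h1
  refine (Set.finite_singleton a).subset fun x hx => ?_
  funext i
  rw [Subsingleton.elim i 0]
  exact hx

/-- `N` realizes all types over finite extensions of `M` in `N`. -/
def IsFullOver (L : FirstOrder.Language.{u, v}) {𝕆 : Type w} [L.Structure 𝕆] (M N : Set 𝕆) : Prop :=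
  ∀ (k l : ℕ) (c : Fin k → 𝕆) (b : Fin l → 𝕆), Set.range c ⊆ N →
    ∃ b' : Fin l → 𝕆, Set.range b' ⊆ N ∧ SameType L (M ∪ Set.range c) b' b

/-- This is the Tarski–Vaught test: fullness for single elements over the finitely many parameters
of the definable set. -/
theorem IsFullOver.meetsDefinable {M N : Set 𝕆} (h : IsFullOver L M N) : L.MeetsDefinable N := by
  rintro D ⟨x, hx⟩ hD
  obtain ⟨k, c, hc, hD⟩ := exists_fin_definable hD
  obtain ⟨b, hb, hbx⟩ := h k 1 c (fun _ => x) hc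
  exact ⟨b 0, (hbx _ (hD.mono Set.subset_union_right)).2 hx, hb ⟨0, rfl⟩⟩

theorem IsFullOver.exists_elementarySubstructure {M N : Set 𝕆} (h : IsFullOver L M N) :
    ∃ E : L.ElementarySubstructure 𝕆, (E : Set 𝕆) = N :=
  ⟨h.meetsDefinable.toElementarySubstructure, h.meetsDefinable.closure_eq_self⟩

theorem sumElim_comp_swap {α β γ : Type*} (a : α → γ) (b : β → γ) :
    Sum.elim a b ∘ Sum.swap = Sum.elim b a := by
  funext i
  rcases i with i | i <;> rfl

/-- A type invariant over `M` is strongly bi-invariant over sets that are full over `M`. -/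
theorem isStronglyBiInvariant_of_isFullOver [Nonempty 𝕆] {M N : Set 𝕆} (hMN : M ⊆ N)
    (hN : IsFullOver L M N) {m : ℕ} {p : GlobalType L 𝕆 m} {U : Ultrafilter (Fin m → 𝕆)}
    (hU : Represents U p) (hinv : InvariantUF L U M) : IsStronglyBiInvariant p N := by
  refine ⟨hU.isInvariant_iff.2 (hinv.mono hMN), fun r k a b hab => ?_⟩
  let e : ℕ → Fin m → 𝕆 := fun i =>
    if h : i < r then a ⟨i, h⟩ else fun _ => Classical.arbitrary 𝕆
  have he : (fun i : Fin r => e i) = a := by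
    funext i
    simp [e]
  have heM : MorleyUF L U (N ∪ Set.range b) r e := by
    rw [← he] at hab
    exact hU.realizesPower_iff.1 hab
  have hea : (⋃ i, Set.range (a i)) = entries r e := by
    rw [← he]
    ext x
    simp only [mem_entries, Set.mem_iUnion, Set.mem_range]
    exact ⟨fun ⟨i, hi⟩ => ⟨i, i.2, hi⟩, fun ⟨i, hi, h⟩ => ⟨⟨i, hi⟩, h⟩⟩
  rw [hea, ← range_initial]
  -- A formula true of `b` has finitely many parameters `c` in `N`, besides the sequence. Fullness
  -- gives `b'` in `N` with the type of `b` over `M` and `c`. The sequence is Morley over both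
  -- tuples, so it cannot distinguish them, and `b'` satisfies the formula.
  obtain ⟨W, hW⟩ := exists_ultrafilter_of_meets (L := L) (C := N ∪ Set.range (initial r e))
    (b := b) (fun (x : Fin k → N) i => (x i : 𝕆)) (by
      intro S hS hb
      obtain ⟨S', hS', hx⟩ := exists_definable_fiber_eq hS
      obtain ⟨l, c, hc, hS'⟩ := exists_fin_definable hS'
      obtain ⟨b', hb', hbb⟩ := hN l k c b hc
      have hcN : M ∪ Set.range c ⊆ N := Set.union_subset hMN hc
      have h1 := MorleyUF.sameType (hinv.mono (Set.subset_union_left (t := Set.range c))) hbb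
        (heM.mono (Set.union_subset (hcN.trans Set.subset_union_left)
          (hb'.trans Set.subset_union_left)) le_rfl)
        (heM.mono (Set.union_subset_union_left _ hcN) le_rfl)
      have h2 := (h1.comp Sum.swap) S' (hS'.mono Set.subset_union_right)
      rw [sumElim_comp_swap, sumElim_comp_swap, ← hx, ← hx] at h2
      exact ⟨fun i => ⟨b' i, hb' ⟨i, rfl⟩⟩, h2.2 hb⟩)
  refine invariantlyIndep_iff.2 ⟨W.map fun (x : Fin k → N) i => (x i : 𝕆), ?_, fun S hS => hW S hS⟩
  intro j S hS c c' hc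
  -- The ultrafilter lives on tuples from `N`, and such tuples cannot separate `c` from `c'`, which
  -- have the same type over `N`.
  have : ∀ x : Fin k → N, Sum.elim (fun i => (x i : 𝕆)) c ∈ S ↔
      Sum.elim (fun i => (x i : 𝕆)) c' ∈ S := by
    intro x
    have h1 := definable_fiber (hS.preimage_comp Sum.swap) subset_rfl
      (b := fun i => (x i : 𝕆)) (by rintro _ ⟨i, rfl⟩; exact (x i).2)
    have h2 := hc _ h1
    simpa only [Set.mem_ofPred_eq, Set.mem_preimage, sumElim_comp_swap] using h2
  rw [Ultrafilter.mem_map, Ultrafilter.mem_map]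
  have h3 : (fun (x : Fin k → N) i => (x i : 𝕆)) ⁻¹' {x | Sum.elim x c ∈ S} =
      (fun (x : Fin k → N) i => (x i : 𝕆)) ⁻¹' {x | Sum.elim x c' ∈ S} := Set.ext this
  rw [h3]

end FullSets

/-! ### Absorbing the parameters of a formula into the tuple -/

section Parameters

variable {L : FirstOrder.Language.{u, v}} {𝕆 : Type w} [L.Structure 𝕆] {A C : Set 𝕆} {m k : ℕ}
  {U : Ultrafilter (Fin m → 𝕆)} {c : Fin k → 𝕆}

theorem append_eq (y : Fin m → 𝕆) (c : Fin k → 𝕆) :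
    Fin.append y c = Sum.elim y c ∘ finSumFinEquiv.symm := by
  funext i
  refine Fin.addCases (fun i => ?_) (fun i => ?_) i <;> simp

/-- The type of a tuple extended by constants. -/
def adjoinConst (U : Ultrafilter (Fin m → 𝕆)) (c : Fin k → 𝕆) : Ultrafilter (Fin (m + k) → 𝕆) :=
  U.map fun y => Fin.append y c

theorem mem_adjoinConst {S : Set (Fin (m + k) → 𝕆)} :
    S ∈ adjoinConst U c ↔ {y | Fin.append y c ∈ S} ∈ U :=
  Iff.rfl

theorem InvariantUF.adjoinConst (hU : InvariantUF L U A) (hc : Set.range c ⊆ A) :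
    InvariantUF L (adjoinConst U c) A := by
  intro l S hS b b' hb
  let g : Fin (m + k) ⊕ Fin l → (Fin m ⊕ Fin l) ⊕ Fin k :=
    Sum.elim (fun i => (finSumFinEquiv.symm i).elim (fun i => Sum.inl (Sum.inl i)) Sum.inr)
      fun j => Sum.inl (Sum.inr j)
  have key : ∀ (y : Fin m → 𝕆) (b : Fin l → 𝕆),
      Sum.elim (Sum.elim y b) c ∘ g = Sum.elim (Fin.append y c) b := by
    intro y b
    funext i
    rcases i with i | i
    · refine Fin.addCases (fun i => ?_) (fun i => ?_) i <;> simp [g]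
    · rfl
  have := hU l _ (definable_fiber (hS.preimage_comp g) subset_rfl hc) b b' hb
  simpa only [mem_adjoinConst, Set.mem_ofPred_eq, Set.mem_preimage, key] using this

theorem RealizesUF.adjoinConst {a : Fin m → 𝕆} (hU : RealizesUF L U C a) (hc : Set.range c ⊆ C) :
    RealizesUF L (adjoinConst U c) C (Fin.append a c) := by
  intro S hS
  have := hU _ (definable_fiber (hS.preimage_comp finSumFinEquiv.symm) subset_rfl hc)
  simpa only [mem_adjoinConst, Set.mem_ofPred_eq, Set.mem_preimage, ← append_eq] using this

theorem MorleyUF.adjoinConst {r : ℕ} {e : ℕ → Fin m → 𝕆} (hU : MorleyUF L U C r e)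
    (hc : Set.range c ⊆ C) :
    MorleyUF L (adjoinConst U c) C r fun i => Fin.append (e i) c := by
  intro i hi
  refine ((hU i hi).adjoinConst (hc.trans Set.subset_union_left)).mono
    (Set.union_subset Set.subset_union_left ?_)
  intro x hx
  obtain ⟨j, hj, l, rfl⟩ := mem_entries.1 hx
  refine Fin.addCases (fun l => ?_) (fun l => ?_) l
  · simpa using Or.inr (mem_entries.2 ⟨j, hj, l, rfl⟩)
  · simpa using Or.inl (hc ⟨l, rfl⟩)

theorem exists_formula_append {n : ℕ} (φ : L[[A]].Formula (Fin n ⊕ Fin m)) :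
    ∃ (k : ℕ) (c : Fin k → 𝕆) (ψ : L.Formula (Fin n ⊕ Fin (m + k))), Set.range c ⊆ A ∧
      ∀ (x : Fin n → 𝕆) (y : Fin m → 𝕆),
        φ.Realize (Sum.elim x y) ↔ ψ.Realize (Sum.elim x (Fin.append y c)) := by
  obtain ⟨k, c, hc, hS⟩ := exists_fin_definable (L := L) ⟨φ, rfl⟩
  rw [← Set.empty_union (Set.range c)] at hS
  obtain ⟨S', hS', hx⟩ := exists_definable_fiber_eq hS
  obtain ⟨ψ, rfl⟩ := Set.empty_definable_iff.1 hS'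
  let g : (Fin n ⊕ Fin m) ⊕ Fin k → Fin n ⊕ Fin (m + k) :=
    Sum.elim (Sum.elim Sum.inl fun i => Sum.inr (Fin.castAdd k i)) fun i => Sum.inr (Fin.natAdd m i)
  refine ⟨k, c, ψ.relabel g, hc, fun x y => (hx (Sum.elim x y)).trans ?_⟩
  change ψ.Realize _ ↔ (ψ.relabel g).Realize _
  rw [FirstOrder.Language.Formula.realize_relabel]
  have : Sum.elim x (Fin.append y c) ∘ g = Sum.elim (Sum.elim x y) c := by
    funext i
    rcases i with (i | i) | i <;> simp [g]
  rw [this]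

end Parameters

/-! ### Coding invariant types by data over `M` -/

section Traces

variable {L : FirstOrder.Language.{u, v}} {𝕆 : Type w} [L.Structure 𝕆] [Nonempty 𝕆] {M C : Set 𝕆}
  {m : ℕ}

/-- The `M`-formulas `φ(y, b)` that belong to the type defined by `U`, up to the type of `b`
over `M`. -/
def traces (L : FirstOrder.Language.{u, v}) {𝕆 : Type w} [L.Structure 𝕆] [Nonempty 𝕆] {m : ℕ}
    (M : Set 𝕆) (U : Ultrafilter (Fin m → 𝕆)) :
    Set (Σ k : ℕ, L[[M]].Formula (Fin m ⊕ Fin k) × TypeOver L M k) :=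
  {z | ∃ b, tp M b = z.2.2 ∧ {x | z.2.1.Realize (Sum.elim x b)} ∈ U}

theorem InvariantUF.mem_traces_iff {U : Ultrafilter (Fin m → 𝕆)} (hU : InvariantUF L U M) {k : ℕ}
    {φ : L[[M]].Formula (Fin m ⊕ Fin k)} {b : Fin k → 𝕆} :
    (⟨k, φ, tp M b⟩ : Σ k : ℕ, L[[M]].Formula (Fin m ⊕ Fin k) × TypeOver L M k) ∈ traces L M U ↔
      {x | φ.Realize (Sum.elim x b)} ∈ U := by
  constructor
  · rintro ⟨b', hb, hU'⟩
    exact (hU k _ ⟨φ, rfl⟩ b' b (tp_eq_iff.1 hb)).1 hU'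
  · exact fun h => ⟨b, rfl, h⟩

/-- Parameters in `C` enter an invariant type only through their type over `M`, which the traces
record. -/
theorem RealizesUF.of_traces_eq {U V : Ultrafilter (Fin m → 𝕆)} (hU : InvariantUF L U M)
    (hV : InvariantUF L V M) (h : traces L M U = traces L M V) {a : Fin m → 𝕆}
    (ha : RealizesUF L U C a) : RealizesUF L V C a := by
  intro S hS
  rw [← ha S hS]
  obtain ⟨k, c, hc, hS⟩ := exists_fin_definable hS
  obtain ⟨S', hS', hx⟩ := exists_definable_fiber_eq
    (hS.mono (Set.subset_union_right (s := M)))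
  obtain ⟨φ, rfl⟩ := hS'
  have hS2 : S = {x | φ.Realize (Sum.elim x c)} := Set.ext hx
  rw [hS2, ← hU.mem_traces_iff, ← hV.mem_traces_iff, h]

end Traces

/-! ### Counting formulas and types -/

section Cardinality

open Cardinal

theorem mk_sigma_nat_le {f : ℕ → Type w} {κ : Cardinal.{w}} (hκ : ℵ₀ ≤ κ) (hf : ∀ i, #(f i) ≤ κ) :
    #(Σ i, f i) ≤ κ := by
  rw [mk_sigma]
  refine (sum_le_sum _ (fun _ => κ) hf).trans ?_
  rw [sum_const]
  simpa using mul_le_of_le hκ hκ le_rfl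

theorem mk_sigma_le {ι : Type w} {f : ι → Type w} {κ : Cardinal.{w}} (hκ : ℵ₀ ≤ κ) (hι : #ι ≤ κ)
    (hf : ∀ i, #(f i) ≤ κ) : #(Σ i, f i) ≤ κ := by
  rw [mk_sigma]
  refine (sum_le_sum _ (fun _ => κ) hf).trans ?_
  rw [sum_const']
  exact mul_le_of_le hκ hι le_rfl

theorem mk_iUnion_le_of_le {ι α : Type w} {f : ι → Set α} {κ : Cardinal.{w}} (hκ : ℵ₀ ≤ κ)
    (hι : #ι ≤ κ) (hf : ∀ i, #(f i) ≤ κ) : #(⋃ i, f i) ≤ κ := by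
  refine mk_iUnion_le_sum_mk.trans ?_
  rw [← mk_sigma]
  exact mk_sigma_le hκ hι hf

theorem mk_union_le_of_le {α : Type w} {A B : Set α} {κ : Cardinal.{w}} (hκ : ℵ₀ ≤ κ)
    (hA : #A ≤ κ) (hB : #B ≤ κ) : #(A ∪ B : Set α) ≤ κ :=
  (mk_union_le _ _).trans (add_le_of_le hκ hA hB)

theorem mk_fin_fun_le {α : Type w} {κ : Cardinal.{w}} (hκ : ℵ₀ ≤ κ) (hα : #α ≤ κ) (k : ℕ) :
    #(Fin k → α) ≤ κ := by
  rw [mk_pi]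
  simp only [prod_const, mk_fin, lift_natCast, lift_uzero]
  exact (power_le_power_right hα).trans (power_nat_le hκ)

theorem mk_formula_le (L : FirstOrder.Language.{u, v}) {α : Type w} [Finite α] :
    #(L.Formula α) ≤ max ℵ₀ (Cardinal.lift.{w} L.card) := by
  have h1 : #(L.Formula α) ≤ #(Σ n, L.BoundedFormula α n) :=
    mk_le_of_injective (f := fun φ => ⟨0, φ⟩) fun φ ψ h => by simpa using h
  refine (h1.trans FirstOrder.Language.BoundedFormula.card_le).trans
    (max_le (le_max_left _ _) ?_)
  refine add_le_of_le (le_max_left _ _) ((lift_lt_aleph0.2 ?_).le.trans (le_max_left _ _))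
    (le_max_right _ _)
  exact lt_aleph0_of_finite α

theorem card_withConstants_le {L : FirstOrder.Language.{u, v}} {𝕆 : Type max u v w} {A : Set 𝕆}
    {μ : Cardinal.{max u v w}} (hμ : ℵ₀ ≤ μ) (hL : Cardinal.lift.{max u v w} L.card ≤ μ)
    (hA : #A ≤ μ) : L[[A]].card ≤ μ := by
  rw [FirstOrder.Language.card_withConstants]
  refine add_le_of_le hμ hL ?_
  rwa [lift_id'.{max u v, w}]

theorem mk_formula_withConstants_le {L : FirstOrder.Language.{u, v}} {𝕆 : Type max u v w}
    {A : Set 𝕆} {μ : Cardinal.{max u v w}} (hμ : ℵ₀ ≤ μ) (hL : Cardinal.lift.{max u v w} L.card ≤ μ)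
    (hA : #A ≤ μ) {α : Type} [Finite α] : #(L[[A]].Formula α) ≤ μ := by
  refine (mk_formula_le L[[A]]).trans (max_le hμ ?_)
  simpa using card_withConstants_le hμ hL hA

theorem mk_typeOver_le {L : FirstOrder.Language.{u, v}} {𝕆 : Type max u v w} [L.Structure 𝕆]
    [Nonempty 𝕆] {A : Set 𝕆} {μ : Cardinal.{max u v w}} (hμ : ℵ₀ ≤ μ) (hL : Cardinal.lift.{max u v w} L.card ≤ μ)
    (hA : #A ≤ μ) (k : ℕ) : #(TypeOver L A k) ≤ 2 ^ μ := by
  have h1 : #(TypeOver L A k) ≤ #(Set (L[[A]].Formula (Fin k))) := by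
    refine mk_le_of_injective (f := fun p => {ψ | p.Has ψ}) fun p q h => ?_
    refine SetLike.ext fun σ => ?_
    obtain ⟨ψ, rfl⟩ := (FirstOrder.Language.Formula.equivSentence (L := L[[A]])).surjective σ
    exact Set.ext_iff.1 h ψ
  rw [mk_set] at h1
  exact h1.trans (power_le_power_left two_ne_zero (mk_formula_withConstants_le hμ hL hA))

end Cardinality

/-! ### Full sets in clubs -/

section Clubs

open Cardinal

variable {L : FirstOrder.Language.{u, v}} {𝕆 : Type max u v w} [L.Structure 𝕆] [Nonempty 𝕆]
  {O : L.ElementarySubstructure 𝕆} {M A : Set 𝕆} {κ : Cardinal.{max u v w}}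

/-- Small subsets of a saturated `O` can be enlarged so as to realize all types over their finite
subsets together with `M`. -/
theorem exists_superset_realizing_types {Y : Set 𝕆} (hκ : ℵ₀ ≤ κ)
    (hO : IsSaturated L (Order.succ κ) O)
    (hM : M ⊆ O) (hMκ : #M ≤ κ)
    (hcard : ∀ (k l : ℕ) (c : Fin k → 𝕆), #(TypeOver L (M ∪ Set.range c) l) ≤ κ)
    (hY : Y ∈ subsetsOfCard (O : Set 𝕆) κ) :
    ∃ Z ∈ subsetsOfCard (O : Set 𝕆) κ, Y ⊆ Z ∧ ∀ (k l : ℕ) (c : Fin k → 𝕆) (b : Fin l → 𝕆),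
      Set.range c ⊆ Y → ∃ b' : Fin l → 𝕆, Set.range b' ⊆ Z ∧
        SameType L (M ∪ Set.range c) b' b := by
  classical
  have wit : ∀ (k l : ℕ) (c : Fin k → Y) (t : TypeOver L (M ∪ Set.range fun i => (c i : 𝕆)) l),
      ∃ W : Set 𝕆, W ⊆ O ∧ W.Finite ∧ ∀ b : Fin l → 𝕆, tp _ b = t →
        ∃ b' : Fin l → 𝕆, Set.range b' ⊆ W ∧ SameType L (M ∪ Set.range fun i => (c i : 𝕆)) b' b := by
    intro k l c t
    by_cases ht : ∃ b : Fin l → 𝕆, tp _ b = t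
    · obtain ⟨b, rfl⟩ := ht
      have hc : M ∪ Set.range (fun i => (c i : 𝕆)) ⊆ O :=
        Set.union_subset hM (by rintro _ ⟨i, rfl⟩; exact hY.1 (c i).2)
      have hcκ : #(M ∪ Set.range (fun i => (c i : 𝕆)) : Set 𝕆) ≤ κ :=
        mk_union_le_of_le hκ hMκ ((lt_aleph0_of_finite _).le.trans hκ)
      obtain ⟨b', h1, h2⟩ := exists_sameType_of_isSaturated hO hc hcκ b
      refine ⟨Set.range b', ?_, Set.finite_range _, fun b₁ hb₁ => ⟨b', subset_rfl, ?_⟩⟩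
      · rintro _ ⟨i, rfl⟩
        exact h1 i
      · exact h2.trans (tp_eq_iff.1 hb₁).symm
    · exact ⟨∅, Set.empty_subset _, Set.finite_empty, fun b hb => absurd ⟨b, hb⟩ ht⟩
  choose W hWO hWfin hW using wit
  let I : Type max u v w := Σ k : ℕ, Σ l : ℕ, Σ c : Fin k → Y,
    TypeOver L (M ∪ Set.range fun i => (c i : 𝕆)) l
  have hI : #I ≤ κ := mk_sigma_nat_le hκ fun k => mk_sigma_nat_le hκ fun l =>
    mk_sigma_le hκ (mk_fin_fun_le hκ hY.2.le k) fun c => hcard k l _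
  let Z : Set 𝕆 := Y ∪ ⋃ i : I, W i.1 i.2.1 i.2.2.1 i.2.2.2
  refine ⟨Z, ⟨?_, ?_⟩, Set.subset_union_left, ?_⟩
  · exact Set.union_subset hY.1 (Set.iUnion_subset fun i => hWO _ _ _ _)
  · refine le_antisymm (mk_union_le_of_le hκ hY.2.le ?_) ?_
    · exact mk_iUnion_le_of_le hκ hI fun i =>
        ((lt_aleph0_iff_set_finite.2 (hWfin _ _ _ _)).le.trans hκ)
    · exact hY.2.symm.le.trans (mk_le_mk_of_subset Set.subset_union_left)
  · intro k l c b hc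
    let c' : Fin k → Y := fun i => ⟨c i, hc ⟨i, rfl⟩⟩
    obtain ⟨b', h1, h2⟩ := hW k l c' (tp _ b) b rfl
    refine ⟨b', h1.trans (Set.subset_union_of_subset_right ?_ _), h2⟩
    exact Set.subset_iUnion (fun i : I => W i.1 i.2.1 i.2.2.1 i.2.2.2) ⟨k, l, c', tp _ b⟩

/-- Adding realizations of types alternates with enlarging to a member of `C`. The union of the
resulting `ω`-chain is in `C`, and it is full because a finite tuple from the union already lies in
one stage. -/
theorem exists_mem_club_isFullOver (hκ : ℵ₀ ≤ κ)
    (hO : IsSaturated L (Order.succ κ) O) (hκO : κ ≤ #O)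
    (hM : M ⊆ O) (hMκ : #M ≤ κ)
    (hcard : ∀ (k l : ℕ) (c : Fin k → 𝕆), #(TypeOver L (M ∪ Set.range c) l) ≤ κ)
    (hA : A ⊆ O) (hAκ : #A ≤ κ) {C : Set (Set 𝕆)} (hC : IsClubIn (O : Set 𝕆) κ C) :
    ∃ X ∈ C, M ⊆ X ∧ A ⊆ X ∧ IsFullOver L M X := by
  have step : ∀ Y ∈ C, ∃ X ∈ C, Y ⊆ X ∧ ∀ (k l : ℕ) (c : Fin k → 𝕆) (b : Fin l → 𝕆),
      Set.range c ⊆ Y → ∃ b' : Fin l → 𝕆, Set.range b' ⊆ X ∧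
        SameType L (M ∪ Set.range c) b' b := by
    intro Y hY
    obtain ⟨Z, hZ, hYZ, h⟩ := exists_superset_realizing_types hκ hO hM hMκ hcard (hC.1 hY)
    obtain ⟨X, hX, hZX⟩ := hC.2.1 Z hZ
    refine ⟨X, hX, hYZ.trans hZX, fun k l c b hc => ?_⟩
    obtain ⟨b', h1, h2⟩ := h k l c b hc
    exact ⟨b', h1.trans hZX, h2⟩
  have base : ∃ X ∈ C, M ⊆ X ∧ A ⊆ X := by
    -- `P` is padding: members of `[O]^κ` must have cardinality exactly `κ`.
    obtain ⟨P, hPO, hP⟩ := le_mk_iff_exists_subset.1 (show κ ≤ #(O : Set 𝕆) from hκO)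
    obtain ⟨X, hX, h⟩ := hC.2.1 (M ∪ A ∪ P) ⟨Set.union_subset (Set.union_subset hM hA) hPO,
      le_antisymm (mk_union_le_of_le hκ (mk_union_le_of_le hκ hMκ hAκ) hP.le)
        (hP.symm.le.trans (mk_le_mk_of_subset Set.subset_union_right))⟩
    exact ⟨X, hX, (Set.subset_union_left.trans Set.subset_union_left).trans h,
      (Set.subset_union_right.trans Set.subset_union_left).trans h⟩
  choose! next hnext hsub hreal using step
  obtain ⟨X₀, hX₀, hMX, hAX⟩ := base
  let X : ℕ → Set 𝕆 := fun i => next^[i] X₀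
  have hXs : ∀ i, X (i + 1) = next (X i) := fun i => Function.iterate_succ_apply' next i X₀
  have hXC : ∀ i, X i ∈ C := by
    intro i
    induction i with
    | zero => exact hX₀
    | succ i ih =>
      rw [hXs]
      exact hnext _ ih
  have hmono : Monotone X := monotone_nat_of_le_succ fun i => by
    rw [hXs]
    exact hsub _ (hXC i)
  refine ⟨⋃₀ Set.range X, hC.2.2 _ (by rintro _ ⟨i, rfl⟩; exact hXC i) (Set.range_nonempty X)
    hmono.isChain_range ((Set.countable_range X).le_aleph0.trans hκ), ?_, ?_, ?_⟩
  · exact hMX.trans (Set.subset_sUnion_of_mem ⟨0, rfl⟩)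
  · exact hAX.trans (Set.subset_sUnion_of_mem ⟨0, rfl⟩)
  · intro k l c b hc
    have hj : ∀ i, ∃ j, c i ∈ X j := fun i => by simpa using hc ⟨i, rfl⟩
    choose j hj using hj
    obtain ⟨b', h1, h2⟩ := hreal (X (Finset.univ.sup j)) (hXC _) k l c b (by
      rintro _ ⟨i, rfl⟩
      exact hmono (Finset.le_sup (Finset.mem_univ i)) (hj i))
    rw [← hXs] at h1
    exact ⟨b', h1.trans (Set.subset_sUnion_of_mem ⟨_, rfl⟩), h2⟩

end Clubs

/-! ### Maximal Morley sequences of instances in a type -/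

section Good

variable {L : FirstOrder.Language.{u, v}} {𝕆 : Type w} [L.Structure 𝕆] [Nonempty 𝕆]

/-- Some Morley sequence of length `t` in `O` over `M` consists of instances of `φ` in the type
defined by `P`. -/
def HasGoodMorley {n m : ℕ} (P : Ultrafilter (Fin n → 𝕆)) (O M : Set 𝕆)
    (φ : L.Formula (Fin n ⊕ Fin m)) (U : Ultrafilter (Fin m → 𝕆)) (t : ℕ) : Prop :=
  ∃ e, MorleyUF L U M t e ∧
    ∀ i < t, Set.range (e i) ⊆ O ∧ {x | φ.Realize (Sum.elim x (e i))} ∈ P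

/-- `A` consists of the entries of a Morley sequence of maximal length, if there is one; a `d`
realizing the type over `M` and `A` would prolong it. The set serves every `U` with traces `K`,
since such types have the same realizations over any set. -/
theorem exists_finite_bounding {n m : ℕ} (P : Ultrafilter (Fin n → 𝕆)) (O M : Set 𝕆)
    (φ : L.Formula (Fin n ⊕ Fin m))
    (K : Set (Σ k : ℕ, L[[M]].Formula (Fin m ⊕ Fin k) × TypeOver L M k)) :
    ∃ A ⊆ O, A.Finite ∧ ∀ U : Ultrafilter (Fin m → 𝕆), InvariantUF L U M → traces L M U = K →
      ∀ d : Fin m → 𝕆, Set.range d ⊆ O → {x | φ.Realize (Sum.elim x d)} ∈ P →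
        RealizesUF L U (M ∪ A) d → ∀ t, HasGoodMorley P O M φ U t := by
  classical
  by_cases h0 : ∃ U₀ : Ultrafilter (Fin m → 𝕆), (InvariantUF L U₀ M ∧ traces L M U₀ = K) ∧
      ∃ t, ¬ HasGoodMorley P O M φ U₀ t
  · obtain ⟨U₀, ⟨hU₀, hK⟩, ht⟩ := h0
    -- The least failing length is not zero, as the empty sequence is good; its predecessor is the
    -- maximal length.
    obtain ⟨t, ht, hmin⟩ : ∃ t, ¬ HasGoodMorley P O M φ U₀ t ∧
        ∀ s < t, HasGoodMorley P O M φ U₀ s :=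
      ⟨Nat.find ht, Nat.find_spec ht, fun s hs => not_not.1 (Nat.find_min ht hs)⟩
    obtain _ | t := t
    · exact absurd ⟨fun _ _ => Classical.arbitrary 𝕆, fun i hi => absurd hi (Nat.not_lt_zero _),
        fun i hi => absurd hi (Nat.not_lt_zero _)⟩ ht
    obtain ⟨e, he, heP⟩ := hmin t t.lt_succ_self
    refine ⟨entries t e, ?_, finite_entries t e, fun U hU hUK d hdO hdP hd => ?_⟩
    · intro x hx
      obtain ⟨j, hj, i, rfl⟩ := mem_entries.1 hx
      exact (heP j hj).1 ⟨i, rfl⟩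
    · refine absurd ⟨fun i => if i < t then e i else d, fun i hi => ?_, fun i hi => ?_⟩ ht
      · have hsub : entries i (fun i => if i < t then e i else d) ⊆ entries i e := by
          intro x hx
          obtain ⟨j, hj, l, hx⟩ := mem_entries.1 hx
          rw [if_pos (by omega)] at hx
          exact mem_entries.2 ⟨j, hj, l, hx⟩
        by_cases h : i < t
        · simp only [h, if_true]
          exact (he i h).mono (Set.union_subset_union_right _ hsub)
        · have hit : i = t := by omega
          simp only [h, if_false]
          rw [hit] at hsub ⊢
          exact (hd.of_traces_eq hU hU₀ (hUK.trans hK.symm)).mono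
            (Set.union_subset_union_right _ hsub)
      · by_cases h : i < t
        · simpa only [h, if_true] using heP i h
        · simpa only [h, if_false] using ⟨hdO, hdP⟩
  · push Not at h0
    exact ⟨∅, Set.empty_subset _, Set.finite_empty, fun U hU hK _ _ _ _ t => h0 U ⟨hU, hK⟩ t⟩

end Good

/-! ### A bounding set for all formulas and invariant types at once -/

section Bounding

open Cardinal

variable {L : FirstOrder.Language.{u, v}} {𝕆 : Type max u v w} [L.Structure 𝕆] [Nonempty 𝕆]

/-- A bounded set of parameters beyond which every `M`-invariant type with an instance of `φ` in the
type defined by `P` has long Morley sequences of such instances. -/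
theorem exists_bounding {n : ℕ} (P : Ultrafilter (Fin n → 𝕆)) (O M : Set 𝕆)
    {μ : Cardinal.{max u v w}} (hμ : ℵ₀ ≤ μ) (hL : Cardinal.lift.{max u v w} L.card ≤ μ)
    (hM : #M ≤ μ) :
    ∃ A ⊆ O, #A ≤ 2 ^ (2 ^ μ : Cardinal.{max u v w}) ∧
      ∀ (m : ℕ) (φ : L.Formula (Fin n ⊕ Fin m)) (U : Ultrafilter (Fin m → 𝕆)),
        InvariantUF L U M → ∀ d : Fin m → 𝕆, Set.range d ⊆ O →
          {x | φ.Realize (Sum.elim x d)} ∈ P → RealizesUF L U (M ∪ A) d →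
            ∀ t, HasGoodMorley P O M φ U t := by
  have h1 : μ ≤ 2 ^ μ := (cantor μ).le
  have h2 : (2 ^ μ : Cardinal.{max u v w}) ≤ 2 ^ (2 ^ μ : Cardinal.{max u v w}) := (cantor _).le
  have hκ : ℵ₀ ≤ 2 ^ (2 ^ μ : Cardinal.{max u v w}) := (hμ.trans h1).trans h2
  choose A hAO hAfin hA using fun (m : ℕ) (φ : L.Formula (Fin n ⊕ Fin m))
    (K : Set (Σ k : ℕ, L[[M]].Formula (Fin m ⊕ Fin k) × TypeOver L M k)) =>
      exists_finite_bounding P O M φ K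
  -- There are at most `μ` formulas over `M` and `2 ^ μ` types over `M`; a code is a set of such
  -- pairs, which accounts for the second exponential.
  have hkey : ∀ m : ℕ, #(Set (Σ k : ℕ, L[[M]].Formula (Fin m ⊕ Fin k) × TypeOver L M k)) ≤
      2 ^ (2 ^ μ : Cardinal.{max u v w}) := by
    intro m
    rw [mk_set]
    refine power_le_power_left two_ne_zero (mk_sigma_nat_le (hμ.trans h1) fun k => ?_)
    rw [mk_prod, lift_id, lift_id]
    exact mul_le_of_le (hμ.trans h1) ((mk_formula_withConstants_le hμ hL hM).trans h1)
      (mk_typeOver_le hμ hL hM k)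
  let I : Type max u v w := Σ m : ℕ, ULift.{w} (L.Formula (Fin n ⊕ Fin m)) ×
    Set (Σ k : ℕ, L[[M]].Formula (Fin m ⊕ Fin k) × TypeOver L M k)
  have hI : #I ≤ 2 ^ (2 ^ μ : Cardinal.{max u v w}) := by
    refine mk_sigma_nat_le hκ fun m => ?_
    rw [mk_prod, lift_id, lift_id]
    refine mul_le_of_le hκ ?_ (hkey m)
    rw [mk_uLift]
    refine le_trans ?_ (h1.trans h2)
    have h := lift_le.{w}.2 (mk_formula_le L (α := Fin n ⊕ Fin m))
    refine h.trans ?_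
    rw [lift_max, lift_aleph0]
    refine max_le hμ ?_
    rw [lift_umax.{max u v, w}] at hL
    simpa using hL
  refine ⟨⋃ i : I, A i.1 i.2.1.down i.2.2, Set.iUnion_subset fun i => hAO _ _ _,
    mk_iUnion_le_of_le hκ hI fun i => ((lt_aleph0_iff_set_finite.2 (hAfin _ _ _)).le.trans hκ), ?_⟩
  intro m φ U hU d hdO hdP hd
  refine hA m φ _ U hU rfl d hdO hdP (hd.mono (Set.union_subset_union_right _ ?_))
  exact Set.subset_iUnion (fun i : I => A i.1 i.2.1.down i.2.2) ⟨m, ⟨φ⟩, traces L M U⟩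

end Bounding

/-! ### Failure of local character refutes Kim's lemma -/

section Failure

open Cardinal

variable {L : FirstOrder.Language.{u, v}} {𝕆 : Type w} [L.Structure 𝕆] [Nonempty 𝕆]
  {M N O : Set 𝕆}

/-- Failure of `Ξ`, with the parameters from `M` moved into the tuple. -/
theorem exists_of_not_xi (hMO : M ⊆ O) (hMN : M ⊆ N) {n : ℕ} {p : TypeOver L O n}
    {P : Ultrafilter (Fin n → 𝕆)} (hP : Represents P p) (h : ¬ Xi hMO hMN p) :
    ∃ (m : ℕ) (φ : L.Formula (Fin n ⊕ Fin m)) (d : Fin m → 𝕆) (U V : Ultrafilter (Fin m → 𝕆)),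
      Set.range d ⊆ O ∧ {x | φ.Realize (Sum.elim x d)} ∈ P ∧ InvariantUF L U M ∧
      RealizesUF L U N d ∧ InvariantUF L V N ∧ RealizesUF L V N d ∧
      ∃ e, (∀ r, MorleyUF L V N r e) ∧ ∃ k, ¬ Con φ e (Finset.range k) := by
  unfold Xi KimDivides at h
  push Not at h
  obtain ⟨m, φ, d, hφ, hd, q, hq, hqd, e, he, hφe⟩ := h
  obtain ⟨U, hU, hUd⟩ := invariantlyIndep_iff.1 hd
  obtain ⟨V, hV⟩ := q.exists_represents
  obtain ⟨k, c, ψ, hc, hψ⟩ := exists_formula_append φ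
  have hVi := hV.isInvariant_iff.1 hq
  have hVd := hV.realizesRestriction_iff.1 hqd
  refine ⟨m + k, ψ, Fin.append (fun j => (d j : 𝕆)) c, adjoinConst U c, adjoinConst V c, ?_, ?_,
    hU.adjoinConst hc, hUd.adjoinConst (hc.trans hMN), hVi.adjoinConst (hc.trans hMN),
    hVd.adjoinConst (hc.trans hMN), fun i => Fin.append (e i) c,
    fun r => MorleyUF.adjoinConst (hV.isMorleySequence_iff.1 he r) (hc.trans hMN), ?_⟩
  · rintro _ ⟨i, rfl⟩
    refine Fin.addCases (fun i => ?_) (fun i => ?_) i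
    · simp
    · simpa using hMO (hc ⟨i, rfl⟩)
  · rw [hP] at hφ
    simpa only [realize_plug, realize_lift, hψ] using hφ
  · by_contra! hcon
    refine hφe fun s _ => ?_
    obtain ⟨r, hr⟩ := s.exists_nat_subset_range
    obtain ⟨x, hx⟩ := hcon r
    refine ⟨x, fun i hi => ?_⟩
    rw [realize_lift, hψ]
    exact hx i (hr hi)

end Failure

/-- The type `U` witnessing `d ⫝ⁱ_M N` and the type `V` along which the formula Kim-divides over `N`
are the two types required; the choice of `N` in the club makes `U` strongly bi-invariant and
non-dividing. -/
theorem strongBiInvariantKimFailure_of_not_genericStationaryLocalCharacter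
    {L : FirstOrder.Language.{u, v}} {T : L.Theory}
    (hT : ∀ K : FirstOrder.Language.Theory.ModelType.{u, v, max u v w} T, Infinite K)
    (h : ¬ GenericStationaryLocalCharacter.{u, v, max u v w} T) :
    StrongBiInvariantKimFailure.{u, v, max u v w} T := by
  unfold GenericStationaryLocalCharacter IsStationaryIn at h
  push Not at h
  obtain ⟨lam, h⟩ := h
  let μ : Cardinal.{max u v w} :=
    max (max lam Cardinal.aleph0) (Cardinal.lift.{max u v w} L.card)
  have hμ : Cardinal.aleph0 ≤ μ := (le_max_right _ _).trans (le_max_left _ _)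
  have hL : Cardinal.lift.{max u v w} L.card ≤ μ := le_max_right _ _
  have h1 : μ ≤ 2 ^ μ := (Cardinal.cantor μ).le
  have h2 : (2 ^ μ : Cardinal.{max u v w}) ≤ 2 ^ (2 ^ μ : Cardinal.{max u v w}) :=
    (Cardinal.cantor _).le
  obtain ⟨𝕆, O, hsat, hO, n, p, M, hMO, hMlam, C, hC, hempty⟩ :=
    h (2 ^ (2 ^ μ : Cardinal.{max u v w}))
  have hMμ : Cardinal.mk (M : Set 𝕆) ≤ μ :=
    hMlam.trans ((le_max_left _ _).trans (le_max_left _ _))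
  have hOinf : Infinite O := hT (FirstOrder.Language.Theory.ModelType.of T O)
  have hκO := hO.lt_mk.le
  obtain ⟨P, hP⟩ := p.exists_represents
  obtain ⟨A, hAO, hAκ, hA⟩ := exists_bounding.{u, v, w} P (O : Set 𝕆) (M : Set 𝕆) hμ hL hMμ
  obtain ⟨X, hXC, hMX, hAX, hfull⟩ := exists_mem_club_isFullOver.{u, v, w} ((hμ.trans h1).trans h2)
    hO hκO hMO ((hMμ.trans h1).trans h2) (fun k l c => (mk_typeOver_le.{u, v, w} hμ hL
      (mk_union_le_of_le hμ hMμ ((Cardinal.lt_aleph0_of_finite _).le.trans hμ)) l).trans h2)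
    hAO hAκ hC
  obtain ⟨N, rfl⟩ := hfull.exists_elementarySubstructure
  have hNκ := (hC.1 hXC).2
  have hXi : ¬ Xi hMO hMX p := fun hXi =>
    Set.eq_empty_iff_forall_notMem.1 hempty N ⟨⟨N, hMX, rfl, (hC.1 hXC).1, hNκ.le, hXi⟩, hXC⟩
  obtain ⟨m, φ, d, U, V, hdO, hdP, hU, hUd, hV, hVd, hdiv⟩ := exists_of_not_xi hMO hMX hP hXi
  have hgood := hA m φ U hU d hdO hdP (hUd.mono (Set.union_subset hMX hAX))
  have hUr := represents_ofUltrafilter (L := L) Set.univ U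
  have hVr := represents_ofUltrafilter (L := L) Set.univ V
  refine ⟨𝕆, N, hsat.mono (Order.succ_le_succ (hNκ.le.trans hκO)), n, m, φ, d, _, _,
    isStronglyBiInvariant_of_isFullOver hMX hfull hUr hU, hUr.realizesRestriction_iff.2 hUd,
    hVr.isInvariant_iff.2 hV, hVr.realizesRestriction_iff.2 hVd,
    (kimDividesAlong_iff hVr).2 hdiv, ?_⟩
  rw [kimDividesAlong_iff hUr]
  rintro ⟨e, he, k, hk⟩
  -- The sequence `c` is Morley only over `M`, which suffices: `U` is `M`-invariant, so `c` and the
  -- first `k` members of `e` have the same type over `M`. Along `c` the instances are consistent,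
  -- as finitely many members of the ultrafilter `P`.
  obtain ⟨c, hc, hcP⟩ := hgood k
  refine hk ((con_range_congr φ (((he k).mono hMX le_rfl).sameType_initial hU hc)).2 ?_)
  have hmem : (⋂ i ∈ Finset.range k, {x | φ.Realize (Sum.elim x (c i))}) ∈ P :=
    (Filter.biInter_finset_mem _).2 fun i hi => (hcP i (Finset.mem_range.1 hi)).2
  obtain ⟨x, hx⟩ := Ultrafilter.nonempty_of_mem hmem
  exact ⟨x, fun i hi => Set.mem_iInter₂.1 hx i hi⟩

end LocalCharacter

theorem mainTheorem8 {L : FirstOrder.Language.{u, v}} (T : L.Theory)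
    (hT : ∀ K : FirstOrder.Language.Theory.ModelType.{u, v, max u v w} T, Infinite K) :
    (LocalCharacter.IsNATP.{u, v, max u v w} T →
      LocalCharacter.GenericStationaryLocalCharacter.{u, v, max u v w} T) ∧
    (¬ LocalCharacter.GenericStationaryLocalCharacter.{u, v, max u v w} T →
      LocalCharacter.StrongBiInvariantKimFailure.{u, v, max u v w} T) := by
  have key := LocalCharacter.strongBiInvariantKimFailure_of_not_genericStationaryLocalCharacter hT
  refine ⟨fun h => ?_, key⟩
  by_contra hn
  exact h (LocalCharacter.hasATP_of_strongBiInvariantKimFailure hT (key hn))
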